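/- Let $L$ be a closed smooth manifold (compact, Hausdorff, without boundary). For $s\ge 1$ let $\Delta_{L,s}=\{(p_1,\dots,p_s)\in L^s : p_j=p_k \text{ for some } j\ne k\}$ be the big diagonal. Let $J$ be a countable index set and, for each $j\in J$, let $M_j$ be a smooth manifold (Hausdorff, second countable, without boundary), $s_j$ a positive integer, $N_j$ a smooth (embedded, not necessarily closed) submanifold of $L^{s_j}$ contained in $L^{s_j}\setminus\Delta_{L,s_j}$, and $f_j\colon M_j\to L^{s_j}$ a smooth map. Then for every neighbourhood $\mathcal U$ of $\operatorname{id}_L$ in $C^\infty(L,L)$ with its $C^\infty$-topology (uniform convergence, in charts and on compact sets, of all derivatives) there exists a diffeomorphism $\phi$ of $L$ with $\phi\in\mathcal U$ such that, for every $j\in J$, the map $f_j$ is transverse to $\phi^{\times s_j}(N_j)$; that is, for every $p\in M_j$ with $x:=f_j(p)\in \phi^{\times s_j}(N_j)$, \[ \operatorname{Im} D_pf_j+T_{x}\bigl(\phi^{\times s_j}(N_j)\bigr)=T_{x}L^{s_j}. \] Here $\phi^{\times s}(p_1,\dots,p_s)=(\phi(p_1),\dots,\phi(p_s))$. -/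

import Mathlib

open Set Topology
open scoped Manifold ContDiff Pointwise

namespace DiffTop

/-- The big diagonal of `L^s`: the tuples having at least two equal entries. -/
def bigDiagonal (L : Type*) (s : ℕ) : Set (Fin s → L) :=
  {p | ∃ j k : Fin s, j ≠ k ∧ p j = p k}

/-- The product map `φ^{×s} : L^s → L^s`. -/
def powMap {L : Type*} (s : ℕ) (φ : L → L) : (Fin s → L) → (Fin s → L) :=
  fun x i => φ (x i)

section Submanifold

variable {E : Type*} [NormedAddCommGroup E] [NormedSpace ℝ E]
  {H : Type*} [TopologicalSpace H] (J : ModelWithCorners ℝ E H)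
  {Q : Type*} [TopologicalSpace Q] [ChartedSpace H Q]

/-- `R` is a smooth (embedded, not necessarily closed) submanifold of the manifold `Q`: for some
dimension `k`, every point of `R` lies in a chart of the smooth structure of `Q` in which `R`
is exactly the preimage of a `k`-dimensional linear subspace. -/
def IsSubmanifold (R : Set Q) : Prop :=
  ∃ k : ℕ, ∀ x ∈ R, ∃ e ∈ IsManifold.maximalAtlas J ∞ Q, x ∈ e.source ∧
    ∃ V : Submodule ℝ E, Module.finrank ℝ V = k ∧
      ∀ y ∈ e.source, (y ∈ R ↔ e.extend J y ∈ V)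

/-- The tangent space `T_x R ⊆ T_x Q` of a submanifold `R` of `Q` at `x`: the set of velocities at
time `0` of smooth curves in `Q` that stay in `R` and pass through `x` at time `0`. The equality in
the tangent bundle says that `γ 0 = x` and `γ' 0 = v`. -/
def tangentVectors (R : Set Q) (x : Q) : Set (TangentSpace J x) :=
  {v | ∃ (γ : ℝ → Q) (ε : ℝ), 0 < ε ∧ ContMDiffOn 𝓘(ℝ, ℝ) J ∞ γ (Ioo (-ε) ε) ∧
    MapsTo γ (Ioo (-ε) ε) R ∧
    (⟨γ 0, mfderiv 𝓘(ℝ, ℝ) J γ 0 (1 : ℝ)⟩ : TangentBundle J Q) = ⟨x, v⟩}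

variable {E' : Type*} [NormedAddCommGroup E'] [NormedSpace ℝ E']
  {H' : Type*} [TopologicalSpace H'] (I : ModelWithCorners ℝ E' H')
  {P : Type*} [TopologicalSpace P] [ChartedSpace H' P]

/-- `f : P → Q` is transverse to the submanifold `R` of `Q`: for every `p` with `f p ∈ R`,
`Im D_p f + T_{f p} R = T_{f p} Q`. -/
def IsTransverse (f : P → Q) (R : Set Q) : Prop :=
  ∀ p : P, f p ∈ R →
    Set.range (mfderiv I J f p) + tangentVectors J R (f p) = Set.univ

end Submanifold

section SmoothTopology

variable {E : Type*} [NormedAddCommGroup E] [NormedSpace ℝ E]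
  {F : Type*} [NormedAddCommGroup F] [NormedSpace ℝ F]
  (P : Type*) [TopologicalSpace P] [ChartedSpace E P]
  (Q : Type*) [TopologicalSpace Q] [ChartedSpace F Q]

variable {P Q} in
/-- Basic set of the weak topology: the smooth maps `g` such that `g(K)` lies in the domain of
the chart `e'` and, in the charts `e` and `e'`, all derivatives of `g` of order at most `r` are
`ε`-close to those of `f` at the points of `K`. -/
def smoothBasicSet (f : C^∞⟮𝓘(ℝ, E), P; 𝓘(ℝ, F), Q⟯)
    (e : OpenPartialHomeomorph P E) (e' : OpenPartialHomeomorph Q F)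
    (K : Set P) (r : ℕ) (ε : ℝ) : Set C^∞⟮𝓘(ℝ, E), P; 𝓘(ℝ, F), Q⟯ :=
  {g | MapsTo g K e'.source ∧ ∀ x ∈ K, ∀ k ≤ r,
    ‖iteratedFDeriv ℝ k (e' ∘ f ∘ e.symm) (e x) -
      iteratedFDeriv ℝ k (e' ∘ g ∘ e.symm) (e x)‖ < ε}

/-- The (weak) `C^∞`-topology on the set of smooth maps between two manifolds without boundary. -/
@[reducible] def smoothTopology : TopologicalSpace C^∞⟮𝓘(ℝ, E), P; 𝓘(ℝ, F), Q⟯ :=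
  TopologicalSpace.generateFrom
    {W | ∃ (f : C^∞⟮𝓘(ℝ, E), P; 𝓘(ℝ, F), Q⟯)
      (e : OpenPartialHomeomorph P E) (e' : OpenPartialHomeomorph Q F)
      (K : Set P) (r : ℕ) (ε : ℝ),
      e ∈ IsManifold.maximalAtlas 𝓘(ℝ, E) ∞ P ∧ e' ∈ IsManifold.maximalAtlas 𝓘(ℝ, F) ∞ Q ∧
      IsCompact K ∧ K ⊆ e.source ∧ MapsTo f K e'.source ∧ 0 < ε ∧
      W = smoothBasicSet f e e' K r ε}

end SmoothTopology

end DiffTop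

/-!
The diffeomorphisms near the identity contain a family `φ b` parametrized by an open neighbourhood
of `0` in a Banach space such that evaluation at any tuple of distinct points is submersive in `b`:
in one chart, a perturbation interpolating a prescribed value at one point while vanishing at
finitely many others does this for points of a compact set, and composing the families of finitely
many charts does it for all of `L`. As `N j` avoids the big diagonal, `(b, y) ↦ φ b^{×s} y` is then
submersive in `b` along `N j`, so that parametric transversality (Sard's theorem on
finite-dimensional affine subspaces of parameters) makes transversality on a compact local piece of
`M j × N j` hold for a dense set of `b`, which is open by compactness. Countably many pieces cover
all the `M j × N j`, and Baire's theorem gives a `b` arbitrarily close to `0` that is good for all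
of them.
-/

open MeasureTheory Filter

namespace DiffTop

section ImplicitFunction

variable {E F : Type*} [NormedAddCommGroup E] [NormedSpace ℝ E] [CompleteSpace E]
  [NormedAddCommGroup F] [NormedSpace ℝ F] {n : WithTop ℕ∞} {U : Set E} {x : E}

theorem exists_openPartialHomeomorph_contDiffOn_symm (hn : 1 ≤ n) (h₀ : OpenPartialHomeomorph E F)
    (hU : IsOpen U) (hh₀ : ContDiffOn ℝ n h₀ U) (hx₀ : x ∈ h₀.source) (hx : x ∈ U)
    (hinv : (fderiv ℝ h₀ x).IsInvertible) :
    ∃ h : OpenPartialHomeomorph E F, x ∈ h.source ∧ h.source ⊆ U ∧ (∀ y, h y = h₀ y) ∧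
      ContDiffOn ℝ n h.symm h.target := by
  have hW : IsOpen (U ∩ fderiv ℝ h₀ ⁻¹' {A | A.IsInvertible}) :=
    (hh₀.continuousOn_fderiv_of_isOpen hU hn).isOpen_inter_preimage hU ContinuousLinearEquiv.isOpen
  refine ⟨h₀.restrOpen _ hW, ⟨hx₀, hx, hinv⟩, fun y hy => hy.2.1, fun _ => rfl, fun z hz => ?_⟩
  obtain ⟨-, hyU, A, hA⟩ := (h₀.restrOpen _ hW).map_target hz
  refine ((h₀.restrOpen _ hW).contDiffAt_symm (f₀' := A) hz ?_
    (hh₀.contDiffAt (hU.mem_nhds hyU))).contDiffWithinAt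
  rw [hA]
  exact (hh₀.differentiableOn (by positivity)).hasFDerivAt (hU.mem_nhds hyU)

variable [FiniteDimensional ℝ F] {f : E → F}

theorem exists_implicit_coordinates (hn : 1 ≤ n) (hU : IsOpen U) (hf : ContDiffOn ℝ n f U)
    (hx : x ∈ U) (hsurj : Function.Surjective (fderiv ℝ f x)) :
    ∃ h : OpenPartialHomeomorph E (F × (fderiv ℝ f x).ker), x ∈ h.source ∧ h.source ⊆ U ∧
      (∀ y, (h y).1 = f y) ∧ ContDiffOn ℝ n h.symm h.target := by
  have : CompleteSpace F := FiniteDimensional.complete ℝ F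
  have hker := (fderiv ℝ f x).ker_closedComplemented_of_finiteDimensional_range
  set φ := HasStrictFDerivAt.implicitFunctionDataOfComplemented f (fderiv ℝ f x)
    ((hf.contDiffAt (hU.mem_nhds hx)).hasStrictFDerivAt (by positivity))
    (LinearMap.range_eq_top.2 hsurj) hker
  have hφ : ContDiffOn ℝ n φ.prodFun U :=
    hf.prodMk ((Classical.choose hker).contDiff.comp (contDiff_id.sub contDiff_const)).contDiffOn
  obtain ⟨h, hxh, hhU, hcoe, hsymm⟩ := exists_openPartialHomeomorph_contDiffOn_symm hn
    φ.toOpenPartialHomeomorph hU hφ φ.pt_mem_toOpenPartialHomeomorph_source hx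
    φ.isInvertible_fderiv_prodFun
  exact ⟨h, hxh, hhU, fun y => by rw [hcoe]; rfl, hsymm⟩

theorem exists_parametrization_zeroSet (hn : 1 ≤ n) (hU : IsOpen U) (hf : ContDiffOn ℝ n f U)
    (hx : x ∈ U) (hsurj : Function.Surjective (fderiv ℝ f x)) :
    ∃ W ∈ 𝓝 x, ∃ V : Set (fderiv ℝ f x).ker, IsOpen V ∧ ∃ ζ : (fderiv ℝ f x).ker → E,
      ContDiffOn ℝ n ζ V ∧ MapsTo ζ V (U ∩ f ⁻¹' {0}) ∧ W ∩ f ⁻¹' {0} ⊆ ζ '' V := by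
  obtain ⟨h, hxh, hhU, hfst, hsymm⟩ := exists_implicit_coordinates hn hU hf hx hsurj
  have hslice : ContDiff ℝ n fun κ : (fderiv ℝ f x).ker => ((0 : F), κ) :=
    contDiff_const.prodMk contDiff_id
  refine ⟨h.source, h.open_source.mem_nhds hxh, (fun κ => (0, κ)) ⁻¹' h.target,
    h.open_target.preimage hslice.continuous, fun κ => h.symm (0, κ),
    hsymm.comp hslice.contDiffOn fun κ hκ => hκ, fun κ hκ => ⟨hhU (h.map_target hκ), ?_⟩, ?_⟩
  · rw [mem_preimage, ← hfst, h.right_inv hκ, mem_singleton_iff]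
  · rintro y ⟨hys, hy0⟩
    have hy : h y = (0, (h y).2) := Prod.ext ((hfst y).trans hy0) rfl
    refine ⟨(h y).2, ?_, ?_⟩
    · rw [mem_preimage, ← hy]
      exact h.map_source hys
    · simp only [← hy, h.left_inv hys]

end ImplicitFunction

theorem norm_image_sub_le_of_iteratedFDeriv_eq_zero {E G : Type*} [NormedAddCommGroup E]
    [NormedSpace ℝ E] [NormedAddCommGroup G] [NormedSpace ℝ G] [CompleteSpace G] {s : Set E}
    (hs : Convex ℝ s) {N : ℕ} {g : E → G} (hg : ∀ z ∈ s, ContDiffAt ℝ (N + 1) g z) {C : ℝ}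
    (hC : ∀ z ∈ s, ‖iteratedFDeriv ℝ (N + 1) g z‖ ≤ C) {x y : E} (hx : x ∈ s) (hy : y ∈ s)
    (hvan : ∀ i, 1 ≤ i → i ≤ N → iteratedFDeriv ℝ i g x = 0) :
    ‖g y - g x‖ ≤ C * ‖y - x‖ ^ (N + 1) := by
  have hmem : ∀ t ∈ Icc (0 : ℝ) 1, x + t • (y - x) ∈ s := fun t ht =>
    hs.add_smul_sub_mem hx hy ht
  have htaylor := map_add_eq_sum_add_integral_iteratedFDeriv fun t ht => hg _ (hmem t ht)
  rw [add_sub_cancel, Finset.sum_range_succ', Finset.sum_eq_zero fun i hi => by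
    rw [hvan (i + 1) (by omega) (by simpa using hi)]; simp] at htaylor
  have hremainder : ‖∫ t in (0 : ℝ)..1, (1 - t) ^ N •
      iteratedFDeriv ℝ (N + 1) g (x + t • (y - x)) fun _ => y - x‖ ≤
        C * ‖y - x‖ ^ (N + 1) * |1 - 0| := by
    refine intervalIntegral.norm_integral_le_of_norm_le_const fun t ht => ?_
    rw [uIoc_of_le zero_le_one] at ht
    have hpow : ‖(1 - t) ^ N‖ ≤ 1 := by
      rw [norm_pow, Real.norm_of_nonneg (by linarith [ht.2])]
      exact pow_le_one₀ (by linarith [ht.2]) (by linarith [ht.1])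
    rw [norm_smul]
    refine (mul_le_of_le_one_left (norm_nonneg _) hpow).trans ?_
    refine (ContinuousMultilinearMap.le_opNorm _ _).trans ?_
    rw [Finset.prod_const, Finset.card_fin]
    gcongr
    exact hC _ (hmem t (Ioc_subset_Icc_self ht))
  have hfactorial : ‖((N.factorial : ℝ)⁻¹)‖ ≤ 1 := by
    rw [norm_inv, Real.norm_natCast]
    exact inv_le_one_of_one_le₀ (mod_cast N.factorial_pos)
  have hsub : g y - g x = (N.factorial : ℝ)⁻¹ • ∫ t in (0 : ℝ)..1, (1 - t) ^ N •
      iteratedFDeriv ℝ (N + 1) g (x + t • (y - x)) fun _ => y - x := by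
    rw [htaylor]
    simp
  rw [hsub, norm_smul]
  refine (mul_le_of_le_one_left (norm_nonneg _) hfactorial).trans (hremainder.trans_eq ?_)
  simp

theorem measure_image_eq_zero_of_locally_null {X Y : Type*} [TopologicalSpace X]
    [SecondCountableTopology X] [MeasurableSpace Y] (μ : Measure Y) (f : X → Y) (s : Set X)
    (h : ∀ x ∈ s, ∃ t ∈ 𝓝[s] x, μ (f '' t) = 0) : μ (f '' s) = 0 := by
  choose! t ht h0 using h
  obtain ⟨c, hcs, hc, hsc⟩ := TopologicalSpace.countable_cover_nhdsWithin ht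
  refine measure_mono_null (image_mono hsc) ?_
  rw [image_iUnion₂, measure_biUnion_null_iff hc]
  exact fun x hx => h0 x (hcs hx)

/-- The points of `U` at which the derivatives of `g` of orders `1, …, N` vanish. The
stratification by these sets drives the proof of Sard's theorem for functions. -/
def flatSet {E G : Type*} [NormedAddCommGroup E] [NormedSpace ℝ E] [NormedAddCommGroup G]
    [NormedSpace ℝ G] (U : Set E) (g : E → G) (N : ℕ) : Set E :=
  {x ∈ U | ∀ i, 1 ≤ i → i ≤ N → iteratedFDeriv ℝ i g x = 0}

section FlatSet

variable {E G : Type*} [NormedAddCommGroup E] [NormedSpace ℝ E] [NormedAddCommGroup G]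
  [NormedSpace ℝ G] {U : Set E} {N : ℕ} {x : E}

theorem fderiv_eq_zero_of_mem_flatSet {g : E → G} (hN : 1 ≤ N) (hx : x ∈ flatSet U g N) :
    fderiv ℝ g x = 0 := by
  rw [← norm_eq_zero, ← norm_iteratedFDeriv_one, hx.2 1 le_rfl hN, norm_zero]

theorem mem_flatSet_one {g : E → G} : x ∈ flatSet U g 1 ↔ x ∈ U ∧ fderiv ℝ g x = 0 := by
  refine ⟨fun hx => ⟨hx.1, fderiv_eq_zero_of_mem_flatSet le_rfl hx⟩, fun hx => ⟨hx.1, ?_⟩⟩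
  intro i h1 h2
  obtain rfl : i = 1 := le_antisymm h2 h1
  rw [← norm_eq_zero, norm_iteratedFDeriv_one, hx.2, norm_zero]

theorem iteratedFDeriv_ne_zero_of_mem_flatSet_sdiff {g : E → G}
    (hx : x ∈ flatSet U g N \ flatSet U g (N + 1)) : iteratedFDeriv ℝ (N + 1) g x ≠ 0 := by
  refine fun h0 => hx.2 ⟨hx.1.1, fun i h1 h2 => ?_⟩
  rcases h2.lt_or_eq with h | rfl
  · exact hx.1.2 i h1 (Nat.lt_succ_iff.1 h)
  · exact h0

theorem flatSet_one_subset (g : E → G) (N : ℕ) :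
    flatSet U g 1 ⊆ flatSet U g (N + 1) ∪ ⋃ k, flatSet U g (k + 1) \ flatSet U g (k + 2) := by
  intro x hx
  by_contra! hcon
  simp only [mem_union, mem_iUnion, Set.mem_sdiff, not_or, not_exists, not_and, not_not] at hcon
  have hflat : ∀ k, x ∈ flatSet U g (k + 1) := fun k => Nat.rec hx hcon.2 k
  exact hcon.1 (hflat N)

-- By Taylor's formula `g` is locally Hölder of exponent `N + 1` on the flat set, so that the image
-- has Hausdorff dimension at most `dim E / (N + 1) < 1`.
theorem volume_image_flatSet_of_finrank_le [FiniteDimensional ℝ E] (hU : IsOpen U) {g : E → ℝ}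
    (hg : ContDiffOn ℝ (N + 1) g U) (hN : Module.finrank ℝ E ≤ N) :
    volume (g '' flatSet U g N) = 0 := by
  have holder : dimH (g '' flatSet U g N) ≤ dimH (flatSet U g N) / ((N + 1 : ℕ) : NNReal) := by
    refine dimH_image_le_of_locally_holder_on (by positivity) fun x hx => ?_
    have hcont : ContinuousAt (iteratedFDeriv ℝ (N + 1) g) x :=
      (hg.contDiffAt (hU.mem_nhds hx.1)).continuousAt_iteratedFDeriv (by norm_cast)
    obtain ⟨r, hr, hball⟩ := Metric.eventually_nhds_iff_ball.1
      ((hcont.nnnorm.eventually_lt_const (lt_add_one _)).and (hU.mem_nhds hx.1))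
    refine ⟨‖iteratedFDeriv ℝ (N + 1) g x‖₊ + 1, Metric.ball x r ∩ flatSet U g N,
      inter_mem (mem_nhdsWithin_of_mem_nhds (Metric.ball_mem_nhds x hr)) self_mem_nhdsWithin,
      fun a ha b hb => ?_⟩
    have htaylor := norm_image_sub_le_of_iteratedFDeriv_eq_zero (convex_ball x r)
      (fun z hz => hg.contDiffAt (hU.mem_nhds (hball z hz).2)) (fun z hz => (hball z hz).1.le)
      hb.1 ha.1 hb.2.2
    rw [NNReal.coe_natCast, ENNReal.rpow_natCast, edist_nndist, edist_nndist, nndist_eq_nnnorm,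
      nndist_eq_nnnorm]
    exact_mod_cast (show ‖g a - g b‖₊ ≤ _ * ‖a - b‖₊ ^ (N + 1) from htaylor)
  have hdim : dimH (flatSet U g N) ≤ N := by
    refine (dimH_mono (subset_univ _)).trans ?_
    rw [Real.dimH_univ_eq_finrank]
    exact_mod_cast hN
  have hlt : dimH (g '' flatSet U g N) < ((1 : NNReal) : ENNReal) := by
    refine holder.trans_lt ((ENNReal.div_le_div_right hdim _).trans_lt ?_)
    rw [ENNReal.div_lt_iff (by simp) (by simp)]
    norm_cast
    omega
  have hnull := hausdorffMeasure_of_dimH_lt hlt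
  rwa [NNReal.coe_one, hausdorffMeasure_real] at hnull

theorem exists_contDiffOn_eqOn_zero_flatSet (hU : IsOpen U) {g : E → ℝ} (hg : ContDiffOn ℝ ∞ g U)
    (hN : 1 ≤ N) (hx : x ∈ flatSet U g N \ flatSet U g (N + 1)) :
    ∃ w : E → ℝ, ContDiffOn ℝ ∞ w U ∧ fderiv ℝ w x ≠ 0 ∧ EqOn w 0 (flatSet U g N) := by
  obtain ⟨v, hv⟩ : ∃ v, iteratedFDeriv ℝ (N + 1) g x v ≠ 0 := by
    by_contra! h
    exact iteratedFDeriv_ne_zero_of_mem_flatSet_sdiff hx (ContinuousMultilinearMap.ext h)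
  -- A partial derivative of order `N` of `g` whose derivative at `x` does not vanish.
  set ev := ContinuousMultilinearMap.apply ℝ (fun _ : Fin N => E) ℝ (Fin.tail v)
  have hgN : ContDiffOn ℝ ∞ (iteratedFDeriv ℝ N g) U := fun y hy =>
    ((hg.contDiffAt (hU.mem_nhds hy)).iteratedFDeriv_right (i := N) (m := ∞)
      (by exact_mod_cast le_top)).contDiffWithinAt
  refine ⟨ev ∘ iteratedFDeriv ℝ N g, ev.contDiff.comp_contDiffOn hgN, fun h0 => hv ?_, ?_⟩
  · have hderiv := ev.hasFDerivAt.comp x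
      ((hgN.differentiableOn (by simp)).hasFDerivAt (hU.mem_nhds hx.1.1))
    rw [iteratedFDeriv_succ_apply_left]
    exact DFunLike.congr_fun (hderiv.fderiv.symm.trans h0) (v 0)
  · intro y hy
    simp [hy.2 N hN le_rfl]

theorem volume_image_flatSet_sdiff [FiniteDimensional ℝ E] (hU : IsOpen U) {g : E → ℝ}
    (hg : ContDiffOn ℝ ∞ g U) (hN : 1 ≤ N)
    (hyperplane : ∀ K : Submodule ℝ E, Module.finrank ℝ K + 1 = Module.finrank ℝ E →
      ∀ (V : Set K) (γ : K → ℝ), IsOpen V → ContDiffOn ℝ ∞ γ V →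
        volume (γ '' {κ ∈ V | fderiv ℝ γ κ = 0}) = 0) :
    volume (g '' (flatSet U g N \ flatSet U g (N + 1))) = 0 := by
  refine measure_image_eq_zero_of_locally_null _ _ _ fun x hx => ?_
  obtain ⟨w, hw, hwx, hw0⟩ := exists_contDiffOn_eqOn_zero_flatSet hU hg hN hx
  have : CompleteSpace E := FiniteDimensional.complete ℝ E
  have hwx' : (fderiv ℝ w x : E →ₗ[ℝ] ℝ) ≠ 0 := fun h => hwx (ContinuousLinearMap.coe_injective h)
  have hsurj : Function.Surjective (fderiv ℝ w x) := LinearMap.surjective hwx'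
  obtain ⟨W, hW, V, hV, ζ, hζ, hζU, hWV⟩ :=
    exists_parametrization_zeroSet (by simp) hU hw hx.1.1 hsurj
  refine ⟨W ∩ (flatSet U g N \ flatSet U g (N + 1)),
    inter_mem (mem_nhdsWithin_of_mem_nhds hW) self_mem_nhdsWithin, measure_mono_null ?_
      (hyperplane _ (Module.Dual.finrank_ker_add_one_of_ne_zero hwx') V (g ∘ ζ) hV
        (hg.comp hζ fun κ hκ => (hζU hκ).1))⟩
  rintro _ ⟨y, ⟨hyW, hy, -⟩, rfl⟩
  obtain ⟨κ, hκ, rfl⟩ := hWV ⟨hyW, hw0 hy⟩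
  refine ⟨κ, ⟨hκ, ?_⟩, rfl⟩
  have hgζ := (hg.differentiableOn (by simp)).hasFDerivAt (hU.mem_nhds hy.1)
  rw [fderiv_eq_zero_of_mem_flatSet hN hy] at hgζ
  have hd := hgζ.comp κ ((hζ.differentiableOn (by simp)).hasFDerivAt (hV.mem_nhds hκ))
  exact hd.fderiv.trans (ContinuousLinearMap.zero_comp _)

end FlatSet

theorem volume_image_fderiv_eq_zero {E : Type*} [NormedAddCommGroup E] [NormedSpace ℝ E]
    [FiniteDimensional ℝ E] {U : Set E} (hU : IsOpen U) {g : E → ℝ} (hg : ContDiffOn ℝ ∞ g U) :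
    volume (g '' {x ∈ U | fderiv ℝ g x = 0}) = 0 := by
  induction hm : Module.finrank ℝ E generalizing E with
  | zero =>
    have : Subsingleton E := Module.finrank_zero_iff.1 hm
    exact (subsingleton_of_subsingleton.image g).measure_zero _
  | succ m ih =>
    have hflat : {x ∈ U | fderiv ℝ g x = 0} = flatSet U g 1 := ext fun _ => mem_flatSet_one.symm
    rw [hflat]
    refine measure_mono_null (image_mono (flatSet_one_subset g m)) ?_
    rw [image_union, image_iUnion]
    refine measure_union_null ?_ (measure_iUnion_null fun k => ?_)
    · exact volume_image_flatSet_of_finrank_le hU (hg.of_le (by exact_mod_cast le_top)) hm.le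
    · exact volume_image_flatSet_sdiff hU hg (by omega) fun K hK V γ hV hγ => ih hV hγ (by omega)

theorem isOpen_setOf_surjective {E F : Type*} [NormedAddCommGroup E] [NormedSpace ℝ E]
    [NormedAddCommGroup F] [NormedSpace ℝ F] [FiniteDimensional ℝ F] :
    IsOpen {A : E →L[ℝ] F | Function.Surjective A} := by
  have : CompleteSpace F := FiniteDimensional.complete ℝ F
  refine isOpen_iff_mem_nhds.2 fun A hA => ?_
  obtain ⟨S, hS⟩ := (A : E →ₗ[ℝ] F).exists_rightInverse_of_surjective (LinearMap.range_eq_top.2 hA)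
  have hAS : A.comp (LinearMap.toContinuousLinearMap S) = (ContinuousLinearEquiv.refl ℝ F) :=
    ContinuousLinearMap.ext fun y => DFunLike.congr_fun hS y
  have hcont : Continuous fun A' : E →L[ℝ] F => A'.comp (LinearMap.toContinuousLinearMap S) := by
    fun_prop
  filter_upwards [(ContinuousLinearEquiv.isOpen.preimage hcont).mem_nhds ⟨_, hAS.symm⟩]
    with A' ⟨e, he⟩
  intro y
  obtain ⟨z, rfl⟩ := e.surjective y
  exact ⟨S z, (DFunLike.congr_fun he z).symm⟩

theorem apply_eq_zero_of_finrank_range_eq {𝕜 E F G : Type*} [DivisionRing 𝕜] [AddCommGroup E]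
    [Module 𝕜 E] [AddCommGroup F] [Module 𝕜 F] [FiniteDimensional 𝕜 F] [AddCommGroup G] [Module 𝕜 G]
    [FiniteDimensional 𝕜 G] {A : E →ₗ[𝕜] F} {B : F →ₗ[𝕜] G}
    (hrank : Module.finrank 𝕜 A.range = Module.finrank 𝕜 G)
    (hsurj : Function.Surjective (B ∘ₗ A)) {v : E} (hv : B (A v) = 0) : A v = 0 := by
  have hBsurj : Function.Surjective (B.domRestrict A.range) := fun y => by
    obtain ⟨v, hv⟩ := hsurj y
    exact ⟨A.rangeRestrict v, hv⟩
  have hBinj := (LinearMap.injective_iff_surjective_of_finrank_eq_finrank hrank).2 hBsurj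
  have hAv : A.rangeRestrict v = 0 := hBinj (hv.trans (map_zero _).symm)
  exact congrArg Subtype.val hAv

/-- The critical points in `U` of a map between normed spaces. -/
def criticalSet {E F : Type*} [NormedAddCommGroup E] [NormedSpace ℝ E] [NormedAddCommGroup F]
    [NormedSpace ℝ F] (U : Set E) (f : E → F) : Set E :=
  {x ∈ U | ¬ Function.Surjective (fderiv ℝ f x)}

section Sard

variable {E F F₁ F₂ K : Type*} [NormedAddCommGroup E] [NormedSpace ℝ E]
  [NormedAddCommGroup F] [NormedSpace ℝ F] [MeasurableSpace F] [BorelSpace F]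
  [NormedAddCommGroup F₁] [NormedSpace ℝ F₁] [NormedAddCommGroup F₂] [NormedSpace ℝ F₂]
  [NormedAddCommGroup K] [NormedSpace ℝ K]

theorem measure_preimage_eq_zero_of_surjective [FiniteDimensional ℝ E] [MeasurableSpace E]
    [BorelSpace E] (A : E →ₗ[ℝ] F) (hA : Function.Surjective A) (μ : Measure E) (ν : Measure F)
    [μ.IsAddHaarMeasure] [ν.IsAddHaarMeasure] {s : Set F} (hs : ν s = 0) : μ (A ⁻¹' s) = 0 := by
  obtain ⟨c, -, hc⟩ := A.exists_map_addHaar_eq_smul_addHaar μ ν hA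
  have hmeas : Measurable A := (LinearMap.toContinuousLinearMap A).continuous.measurable
  refine Measure.preimage_null_of_map_null hmeas.aemeasurable ?_
  rw [hc, Measure.smul_apply, hs, smul_zero]

theorem hasFDerivAt_slice_left {g : F₁ × K → E} {z : F₁ × K} (hg : DifferentiableAt ℝ g z) :
    HasFDerivAt (fun y => g (y, z.2)) ((fderiv ℝ g z).comp (ContinuousLinearMap.inl ℝ F₁ K)) z.1 :=
  HasFDerivAt.comp (g := g) z.1 hg.hasFDerivAt (hasFDerivAt_prodMk_left z.1 z.2)

theorem hasFDerivAt_slice_right {g : F₁ × K → E} {z : F₁ × K} (hg : DifferentiableAt ℝ g z) :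
    HasFDerivAt (fun k => g (z.1, k)) ((fderiv ℝ g z).comp (ContinuousLinearMap.inr ℝ F₁ K)) z.2 :=
  HasFDerivAt.comp (g := g) z.2 hg.hasFDerivAt (hasFDerivAt_prodMk_right z.1 z.2)

theorem fderiv_comp_inr_eq_zero {f : E → F₁ × F₂} {σ : F₁ × K → E} {z : F₁ × K}
    (hf : DifferentiableAt ℝ f (σ z)) (hσ : DifferentiableAt ℝ σ z)
    (hfst : ∀ᶠ z' in 𝓝 z, (f (σ z')).1 = z'.1)
    (hzero : ∀ v, (fderiv ℝ f (σ z) v).1 = 0 → fderiv ℝ f (σ z) v = 0) :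
    (fderiv ℝ (f ∘ σ) z).comp (ContinuousLinearMap.inr ℝ F₁ K) = 0 := by
  have hd := hf.hasFDerivAt.comp z hσ.hasFDerivAt
  have hd₁ : (ContinuousLinearMap.fst ℝ F₁ F₂).comp ((fderiv ℝ f (σ z)).comp (fderiv ℝ σ z)) =
      ContinuousLinearMap.fst ℝ F₁ K :=
    ((ContinuousLinearMap.fst ℝ F₁ F₂).hasFDerivAt.comp z hd).unique
      (hasFDerivAt_fst.congr_of_eventuallyEq hfst)
  rw [hd.fderiv]
  exact ContinuousLinearMap.ext fun k => hzero _ (DFunLike.congr_fun hd₁ ((0 : F₁), k))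

variable [FiniteDimensional ℝ E] [FiniteDimensional ℝ F]
  [FiniteDimensional ℝ F₂] [FiniteDimensional ℝ K] [MeasurableSpace F₁] [BorelSpace F₁]
  [MeasurableSpace F₂] [BorelSpace F₂] {U : Set E}

theorem measure_image_fderiv_eq_zero [Nontrivial F] (μ : Measure F) [μ.IsAddHaarMeasure]
    (hU : IsOpen U) {g : E → F} (hg : ContDiffOn ℝ ∞ g U) :
    μ (g '' {x ∈ U | fderiv ℝ g x = 0}) = 0 := by
  obtain ⟨v, hv⟩ := exists_ne (0 : F)
  obtain ⟨l, hl⟩ := SeparatingDual.exists_eq_one (R := ℝ) hv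
  have hsurj : Function.Surjective l := fun c => ⟨c • v, by simp [hl]⟩
  refine measure_mono_null ?_ (measure_preimage_eq_zero_of_surjective (l : F →ₗ[ℝ] ℝ) hsurj μ volume
    (volume_image_fderiv_eq_zero hU (l.contDiff.comp_contDiffOn hg)))
  rintro _ ⟨x, ⟨hxU, hx⟩, rfl⟩
  refine ⟨x, ⟨hxU, ?_⟩, rfl⟩
  have hgx := (hg.differentiableOn (by simp)).hasFDerivAt (hU.mem_nhds hxU)
  rw [(l.hasFDerivAt.comp x hgx).fderiv, hx, ContinuousLinearMap.comp_zero]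

theorem measure_prod_image_of_fst_eq [Nontrivial F₂] (μ : Measure F₁) (ν : Measure F₂)
    [ν.IsAddHaarMeasure] {V : Set (F₁ × K)} (hV : IsOpen V)
    {g : F₁ × K → F₁ × F₂} (hg : ContDiffOn ℝ ∞ g V) (hfst : ∀ z ∈ V, (g z).1 = z.1)
    {C : Set (F₁ × K)} (hC : IsCompact C) (hCV : C ⊆ V) :
    (μ.prod ν) (g '' {z ∈ C | (fderiv ℝ g z).comp (ContinuousLinearMap.inr ℝ F₁ K) = 0}) = 0 := by
  have : ProperSpace F₂ := FiniteDimensional.proper_real F₂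
  set A : Set (F₁ × K) := {z ∈ C | (fderiv ℝ g z).comp (ContinuousLinearMap.inr ℝ F₁ K) = 0}
  have hcont : ContinuousOn (fun z => (fderiv ℝ g z).comp (ContinuousLinearMap.inr ℝ F₁ K)) C :=
    ((hg.continuousOn_fderiv_of_isOpen hV (by simp)).mono hCV).clm_comp continuousOn_const
  have hA : IsCompact A :=
    hC.of_isClosed_subset (hcont.preimage_isClosed_of_isClosed hC.isClosed isClosed_singleton)
      (sep_subset _ _)
  have himage : IsCompact (g '' A) := hA.image_of_continuousOn (hg.continuousOn.mono
    fun z hz => hCV hz.1)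
  rw [Measure.measure_prod_null himage.measurableSet]
  refine Eventually.of_forall fun t => ?_
  have hVt : IsOpen ((fun k : K => (t, k)) ⁻¹' V) := hV.preimage (by fun_prop)
  have hgt : ContDiffOn ℝ ∞ (fun k => (g (t, k)).2) ((fun k : K => (t, k)) ⁻¹' V) :=
    contDiff_snd.comp_contDiffOn
      (hg.comp (contDiff_const.prodMk contDiff_id).contDiffOn fun k hk => hk)
  refine measure_mono_null ?_ (measure_image_fderiv_eq_zero ν hVt hgt)
  rintro y ⟨⟨t', k⟩, hz, heq⟩
  obtain rfl : t' = t := (hfst _ (hCV hz.1)).symm.trans (congrArg Prod.fst heq)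
  refine ⟨k, ⟨hCV hz.1, ?_⟩, congrArg Prod.snd heq⟩
  have hd := hasFDerivAt_slice_right ((hg.differentiableOn (by simp)).differentiableAt
    (hV.mem_nhds (hCV hz.1)))
  rw [hz.2] at hd
  exact ((ContinuousLinearMap.snd ℝ F₁ F₂).hasFDerivAt.comp k hd).fderiv.trans
    (ContinuousLinearMap.comp_zero _)

variable [FiniteDimensional ℝ F₁]

-- In coordinates in which the first component of `f` is a linear projection, the points of `S` are
-- flat points of the slices of the second component, and Fubini's theorem applies.
theorem exists_nhdsWithin_measure_prod_image_eq_zero [Nontrivial F₂] (μ : Measure F₁)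
    (ν : Measure F₂) [ν.IsAddHaarMeasure] (hU : IsOpen U) {f : E → F₁ × F₂}
    (hf : ContDiffOn ℝ ∞ f U) {x : E} (hx : x ∈ U)
    (hsurj : Function.Surjective fun v => (fderiv ℝ f x v).1) {S : Set E}
    (hS : ∀ y ∈ S, ∀ v, (fderiv ℝ f y v).1 = 0 → fderiv ℝ f y v = 0) :
    ∃ t ∈ 𝓝[S] x, (μ.prod ν) (f '' t) = 0 := by
  have : CompleteSpace E := FiniteDimensional.complete ℝ E
  have hfx := (hf.differentiableOn (by simp)).hasFDerivAt (hU.mem_nhds hx)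
  have hsurj₁ : Function.Surjective (fderiv ℝ (fun y => (f y).1) x) := by
    rwa [hfx.fst.fderiv]
  obtain ⟨h, hxh, hhU, hfst, hsymm⟩ :=
    exists_implicit_coordinates (f := fun y => (f y).1) (by simp) hU
      (contDiff_fst.comp_contDiffOn hf) hx hsurj₁
  have hfst_symm : ∀ z ∈ h.target, (f (h.symm z)).1 = z.1 := fun z hz => by
    rw [← hfst, h.right_inv hz]
  have : ProperSpace (F₁ × (fderiv ℝ (fun y => (f y).1) x).ker) := FiniteDimensional.proper_real _
  obtain ⟨C, hC, hxC, hCV⟩ := exists_compact_subset h.open_target (h.map_source hxh)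
  refine ⟨(h.source ∩ h ⁻¹' interior C) ∩ S, inter_mem (mem_nhdsWithin_of_mem_nhds
    ((h.isOpen_inter_preimage isOpen_interior).mem_nhds ⟨hxh, hxC⟩)) self_mem_nhdsWithin,
    measure_mono_null ?_ (measure_prod_image_of_fst_eq μ ν h.open_target
      (hf.comp hsymm fun z hz => hhU (h.map_target hz)) hfst_symm hC hCV)⟩
  rintro _ ⟨y, ⟨⟨hys, hyC⟩, hyS⟩, rfl⟩
  have hyt := h.map_source hys
  refine ⟨h y, ⟨interior_subset hyC, fderiv_comp_inr_eq_zero ?_ ?_ ?_ ?_⟩,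
    congrArg f (h.left_inv hys)⟩
  · rw [h.left_inv hys]
    exact (hf.differentiableOn (by simp)).differentiableAt (hU.mem_nhds (hhU hys))
  · exact (hsymm.differentiableOn (by simp)).differentiableAt (h.open_target.mem_nhds hyt)
  · filter_upwards [h.open_target.mem_nhds hyt] using hfst_symm
  · rw [h.left_inv hys]
    exact hS y hyS

-- Split off the range of `fderiv ℝ f x`: at nearby points of the same rank, the derivative is
-- determined by its component in that range.
theorem exists_nhdsWithin_measure_image_eq_zero_of_finrank_range (μ : Measure F)
    [μ.IsAddHaarMeasure] (hU : IsOpen U) {f : E → F} (hf : ContDiffOn ℝ ∞ f U) {x : E} (hx : x ∈ U)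
    (hsurj : ¬ Function.Surjective (fderiv ℝ f x)) :
    ∃ t ∈ 𝓝[{y | Module.finrank ℝ (fderiv ℝ f y).range = Module.finrank ℝ (fderiv ℝ f x).range}] x,
      μ (f '' t) = 0 := by
  set R := (fderiv ℝ f x).range
  obtain ⟨R', hRR'⟩ := R.exists_isCompl
  have hR' : Nontrivial R' := by
    rw [Submodule.nontrivial_iff_ne_bot]
    rintro rfl
    exact hsurj (LinearMap.range_eq_top.1 (eq_top_of_isCompl_bot hRR'))
  set L : F ≃L[ℝ] R × R' := (Submodule.prodEquivOfIsCompl R R' hRR').symm.toContinuousLinearEquiv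
  have hLf : ∀ y ∈ U, fderiv ℝ (L ∘ f) y = (L : F →L[ℝ] R × R').comp (fderiv ℝ f y) := fun y _ =>
    L.comp_fderiv
  have hLR : ∀ y : R, (L y).1 = y := fun y => by simp [L]
  set Φ : E → E →L[ℝ] R := fun y =>
    (ContinuousLinearMap.fst ℝ R R').comp ((L : F →L[ℝ] R × R').comp (fderiv ℝ f y))
  have hΦ : ContinuousOn Φ U := continuousOn_const.clm_comp (continuousOn_const.clm_comp
    (hf.continuousOn_fderiv_of_isOpen hU (by simp)))
  have hΦx : Function.Surjective (Φ x) := by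
    rintro ⟨-, v, rfl⟩
    exact ⟨v, hLR ⟨_, v, rfl⟩⟩
  have hO : U ∩ Φ ⁻¹' {A | Function.Surjective A} ∈ 𝓝 x :=
    (hΦ.isOpen_inter_preimage hU isOpen_setOf_surjective).mem_nhds ⟨hx, hΦx⟩
  obtain ⟨t, ht, hnull⟩ := exists_nhdsWithin_measure_prod_image_eq_zero Measure.addHaar
    Measure.addHaar hU (L.contDiff.comp_contDiffOn hf) hx (by rwa [hLf x hx])
    (S := {y | Module.finrank ℝ (fderiv ℝ f y).range = Module.finrank ℝ R} ∩
      (U ∩ Φ ⁻¹' {A | Function.Surjective A})) (by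
    rintro y ⟨hrank, hyU, hΦy⟩ v hv
    rw [hLf y hyU] at hv ⊢
    have hfv : fderiv ℝ f y v = 0 := apply_eq_zero_of_finrank_range_eq
      (B := LinearMap.fst ℝ R R' ∘ₗ (L : F →ₗ[ℝ] R × R')) hrank hΦy hv
    exact (congrArg L hfv).trans (map_zero L))
  rw [nhdsWithin_inter_of_mem' (mem_nhdsWithin_of_mem_nhds hO)] at ht
  refine ⟨t, ht, measure_mono_null ?_ (measure_preimage_eq_zero_of_surjective
    (L : F →ₗ[ℝ] R × R') L.surjective μ _ hnull)⟩
  rw [image_comp]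
  exact fun y hy => mem_image_of_mem L hy

theorem measure_image_criticalSet (μ : Measure F) [μ.IsAddHaarMeasure] (hU : IsOpen U) {f : E → F}
    (hf : ContDiffOn ℝ ∞ f U) : μ (f '' criticalSet U f) = 0 := by
  have hrank : criticalSet U f ⊆ ⋃ r : ℕ,
      criticalSet U f ∩ {x | Module.finrank ℝ (fderiv ℝ f x).range = r} :=
    fun x hx => mem_iUnion.2 ⟨_, hx, rfl⟩
  refine measure_mono_null (image_mono hrank) ?_
  rw [image_iUnion]
  refine measure_iUnion_null fun r => measure_image_eq_zero_of_locally_null _ _ _ ?_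
  rintro x ⟨⟨hx, hsurj⟩, rfl⟩
  obtain ⟨t, ht, hnull⟩ :=
    exists_nhdsWithin_measure_image_eq_zero_of_finrank_range μ hU hf hx hsurj
  exact ⟨t, nhdsWithin_mono x inter_subset_right ht, hnull⟩

end Sard

theorem exists_finiteDimensional_forall_surjective {X B F : Type*} [TopologicalSpace X]
    [NormedAddCommGroup B] [NormedSpace ℝ B] [NormedAddCommGroup F] [NormedSpace ℝ F]
    [FiniteDimensional ℝ F] {K : Set X} (hK : IsCompact K) {A : X → B →L[ℝ] F}
    (hA : ContinuousOn A K) (hsurj : ∀ x ∈ K, Function.Surjective (A x)) :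
    ∃ T : Submodule ℝ B, FiniteDimensional ℝ T ∧
      ∀ x ∈ K, Function.Surjective ((A x).comp T.subtypeL) := by
  have hmono : ∀ {T T' : Submodule ℝ B}, T ≤ T' → ∀ {x},
      Function.Surjective ((A x).comp T.subtypeL) →
        Function.Surjective ((A x).comp T'.subtypeL) := fun hT x h y => by
    obtain ⟨v, hv⟩ := h y
    exact ⟨⟨v, hT v.2⟩, hv⟩
  refine hK.induction_on (p := fun S => ∃ T : Submodule ℝ B, FiniteDimensional ℝ T ∧
    ∀ x ∈ S, Function.Surjective ((A x).comp T.subtypeL)) ?_ ?_ ?_ ?_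
  · exact ⟨⊥, inferInstance, fun x hx => hx.elim⟩
  · exact fun S S' hSS' ⟨T, hT, h⟩ => ⟨T, hT, fun x hx => h x (hSS' hx)⟩
  · rintro S S' ⟨T, hT, h⟩ ⟨T', hT', h'⟩
    exact ⟨T ⊔ T', inferInstance, fun x hx =>
      hx.elim (fun hx => hmono le_sup_left (h x hx)) fun hx => hmono le_sup_right (h' x hx)⟩
  · intro x hx
    obtain ⟨S, hS⟩ := (A x : B →ₗ[ℝ] F).exists_rightInverse_of_surjective
      (LinearMap.range_eq_top.2 (hsurj x hx))
    have hxS : Function.Surjective ((A x).comp S.range.subtypeL) := fun y =>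
      ⟨⟨S y, y, rfl⟩, DFunLike.congr_fun hS y⟩
    exact ⟨_, (hA.clm_comp continuousOn_const x hx).preimage_mem_nhdsWithin
      (isOpen_setOf_surjective.mem_nhds hxS), S.range, inferInstance, fun y hy => hy⟩

theorem exists_nhds_measure_inter_image_fst_eq_zero {T X : Type*} [TopologicalSpace T]
    [TopologicalSpace X] [MeasurableSpace T] (μ : Measure T) {C : Set X} (hC : IsCompact C)
    {S : Set (T × X)} {t : T} (h : ∀ x ∈ C, ∃ W ∈ 𝓝 (t, x), μ (Prod.fst '' (W ∩ S)) = 0) :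
    ∃ V ∈ 𝓝 t, μ (V ∩ {t' | ∃ x ∈ C, (t', x) ∈ S}) = 0 := by
  refine hC.induction_on (p := fun D => ∃ V ∈ 𝓝 t, μ (V ∩ {t' | ∃ x ∈ D, (t', x) ∈ S}) = 0)
    ?_ ?_ ?_ ?_
  · exact ⟨univ, univ_mem, by simp⟩
  · rintro D D' hDD' ⟨V, hV, h0⟩
    refine ⟨V, hV, measure_mono_null ?_ h0⟩
    rintro t ⟨ht, x, hx, hS⟩
    exact ⟨ht, x, hDD' hx, hS⟩
  · rintro D D' ⟨V, hV, h0⟩ ⟨V', hV', h0'⟩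
    refine ⟨V ∩ V', inter_mem hV hV', measure_mono_null ?_ (measure_union_null h0 h0')⟩
    rintro t ⟨⟨ht, ht'⟩, x, hx | hx, hS⟩
    · exact Or.inl ⟨ht, x, hx, hS⟩
    · exact Or.inr ⟨ht', x, hx, hS⟩
  · intro x hx
    obtain ⟨W, hW, h0⟩ := h x hx
    obtain ⟨V, hV, V', hV', hsub⟩ := mem_nhds_prod_iff.1 hW
    refine ⟨V', mem_nhdsWithin_of_mem_nhds hV', V, hV, measure_mono_null ?_ h0⟩
    rintro t ⟨ht, y, hy, hS⟩
    exact ⟨(t, y), ⟨hsub ⟨ht, hy⟩, hS⟩, rfl⟩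

/-- The zeros `(t, x) ∈ Ω` of a parametrized system of equations `G` at which the slice `G (t, ·)`
is not submersive; parametric transversality says that they occur for few parameters `t` only. -/
def singularZeros {T X F : Type*} [NormedAddCommGroup T] [NormedSpace ℝ T] [NormedAddCommGroup X]
    [NormedSpace ℝ X] [NormedAddCommGroup F] [NormedSpace ℝ F] (Ω : Set (T × X)) (G : T × X → F) :
    Set (T × X) :=
  {z ∈ Ω | G z = 0 ∧
    ¬ Function.Surjective ((fderiv ℝ G z).comp (ContinuousLinearMap.inr ℝ T X))}

section Parametric

variable {T X F : Type*} [NormedAddCommGroup T] [NormedSpace ℝ T] [NormedAddCommGroup X]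
  [NormedSpace ℝ X] [NormedAddCommGroup F] [NormedSpace ℝ F] {Ω : Set (T × X)} {G : T × X → F}

theorem surjective_comp_inr_of_comp_eq_zero {K : Type*} [NormedAddCommGroup K] [NormedSpace ℝ K]
    {A : T × X →L[ℝ] F} {ζ : K →L[ℝ] T × X}
    (hA : Function.Surjective (A.comp (ContinuousLinearMap.inl ℝ T X))) (hAζ : A.comp ζ = 0)
    (hζ : Function.Surjective ((ContinuousLinearMap.fst ℝ T X).comp ζ)) :
    Function.Surjective (A.comp (ContinuousLinearMap.inr ℝ T X)) := by
  intro w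
  obtain ⟨τ, rfl⟩ := hA w
  obtain ⟨κ, rfl⟩ := hζ τ
  have hsum : A ((ζ κ).1, 0) + A (0, (ζ κ).2) = 0 := by
    rw [← map_add, Prod.fst_add_snd]
    exact DFunLike.congr_fun hAζ κ
  refine ⟨-(ζ κ).2, ?_⟩
  rw [map_neg]
  exact (eq_neg_of_add_eq_zero_left hsum).symm

variable {B : Type*} [NormedAddCommGroup B] [NormedSpace ℝ B]

theorem fderiv_comp_add_subtype {Ω : Set (B × X)} (hΩ : IsOpen Ω) {G : B × X → F}
    (hG : ContDiffOn ℝ 1 G Ω) (b : B) (T : Submodule ℝ B) {z : T × X}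
    (hz : (b + (z.1 : B), z.2) ∈ Ω) :
    fderiv ℝ (fun z : T × X => G (b + (z.1 : B), z.2)) z =
      (fderiv ℝ G (b + (z.1 : B), z.2)).comp
        (T.subtypeL.prodMap (ContinuousLinearMap.id ℝ X)) :=
  (HasFDerivAt.comp (g := G) z ((hG.differentiableOn (by simp)).hasFDerivAt (hΩ.mem_nhds hz))
    (((T.subtypeL.hasFDerivAt.comp z hasFDerivAt_fst).const_add b).prodMk hasFDerivAt_snd)).fderiv

theorem singularZeros_comp_add_subtype {Ω : Set (B × X)} (hΩ : IsOpen Ω) {G : B × X → F}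
    (hG : ContDiffOn ℝ 1 G Ω) (b : B) (T : Submodule ℝ B) :
    singularZeros ((fun z : T × X => (b + (z.1 : B), z.2)) ⁻¹' Ω)
        (fun z : T × X => G (b + (z.1 : B), z.2)) =
      (fun z : T × X => (b + (z.1 : B), z.2)) ⁻¹' singularZeros Ω G := by
  ext z
  refine and_congr_right fun hz => and_congr_right fun _ => not_congr ?_
  rw [fderiv_comp_add_subtype hΩ hG b T hz]
  refine iff_of_eq (congrArg Function.Surjective (funext fun x => ?_))
  simp

variable [FiniteDimensional ℝ F]

theorem mem_singularZeros_of_mem_closure (hΩ : IsOpen Ω) (hG : ContDiffOn ℝ 1 G Ω) {z : T × X}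
    (hz : z ∈ Ω) (hzS : z ∈ closure (singularZeros Ω G)) : z ∈ singularZeros Ω G := by
  have hcont := (hG.continuousOn.continuousAt (hΩ.mem_nhds hz))
  have hcont' : ContinuousAt (fun z => (fderiv ℝ G z).comp (ContinuousLinearMap.inr ℝ T X)) z :=
    ((hG.continuousOn_fderiv_of_isOpen hΩ le_rfl).continuousAt (hΩ.mem_nhds hz)).clm_comp
      continuousAt_const
  rw [mem_closure_iff_frequently] at hzS
  refine ⟨hz, ?_, fun hreg => ?_⟩
  · by_contra hne
    obtain ⟨y, hy, hne⟩ := (hzS.and_eventually (hcont.eventually_ne hne)).exists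
    exact hne hy.2.1
  · obtain ⟨y, hy, hreg⟩ := (hzS.and_eventually
      (hcont'.eventually_mem (isOpen_setOf_surjective.mem_nhds hreg))).exists
    exact hy.2.2 hreg

theorem isOpen_setOf_forall_notMem_singularZeros {O : Set T} (hO : IsOpen O) {C : Set X}
    (hC : IsCompact C) (hΩ : IsOpen Ω) (hG : ContDiffOn ℝ 1 G Ω)
    (hclosure : ∀ t ∈ O, ∀ x ∈ C, (t, x) ∈ closure (Ω ∩ G ⁻¹' {0}) → (t, x) ∈ Ω) :
    IsOpen {t ∈ O | ∀ x ∈ C, (t, x) ∉ singularZeros Ω G} := by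
  refine isOpen_iff_mem_nhds.2 ?_
  rintro t ⟨ht, hreg⟩
  refine inter_mem (hO.mem_nhds ht) (hC.eventually_forall_of_forall_eventually fun x hx => ?_)
  have hnot : (t, x) ∉ closure (singularZeros Ω G) := fun hz =>
    hreg x hx (mem_singularZeros_of_mem_closure hΩ hG
      (hclosure t ht x hx (closure_mono (inter_subset_inter_right Ω inter_subset_left) hz)) hz)
  filter_upwards [isClosed_closure.isOpen_compl.mem_nhds hnot] with z hz using
    notMem_of_notMem_closure hz

variable [FiniteDimensional ℝ X]

-- The singular zeros are the critical points of the projection to `T` of the manifold of zeros.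
theorem exists_nhds_measure_image_fst_singularZeros [FiniteDimensional ℝ T] [MeasurableSpace T]
    [BorelSpace T] (μ : Measure T) [μ.IsAddHaarMeasure] (hΩ : IsOpen Ω) (hG : ContDiffOn ℝ ∞ G Ω)
    {z : T × X} (hz : z ∈ Ω)
    (hsurj : Function.Surjective ((fderiv ℝ G z).comp (ContinuousLinearMap.inl ℝ T X))) :
    ∃ W ∈ 𝓝 z, μ (Prod.fst '' (W ∩ singularZeros Ω G)) = 0 := by
  have : CompleteSpace T := FiniteDimensional.complete ℝ T
  have : CompleteSpace X := FiniteDimensional.complete ℝ X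
  have hcont : ContinuousAt (fun z => (fderiv ℝ G z).comp (ContinuousLinearMap.inl ℝ T X)) z :=
    ((hG.continuousOn_fderiv_of_isOpen hΩ (by simp)).continuousAt (hΩ.mem_nhds hz)).clm_comp
      continuousAt_const
  obtain ⟨W, hW, V, hV, ζ, hζ, hζΩ, hWV⟩ := exists_parametrization_zeroSet (by simp) hΩ hG hz
    (Function.Surjective.of_comp (g := ContinuousLinearMap.inl ℝ T X) hsurj)
  refine ⟨W ∩ _, inter_mem hW (hcont.preimage_mem_nhds (isOpen_setOf_surjective.mem_nhds hsurj)),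
    measure_mono_null ?_
      (measure_image_criticalSet μ hV (contDiff_fst.comp_contDiffOn hζ))⟩
  rintro _ ⟨y, ⟨⟨hyW, hyT⟩, hyΩ, hy0, hns⟩, rfl⟩
  obtain ⟨κ, hκ, rfl⟩ := hWV ⟨hyW, hy0⟩
  refine ⟨κ, ⟨hκ, fun hsurj => hns (surjective_comp_inr_of_comp_eq_zero
    (ζ := fderiv ℝ ζ κ) hyT ?_ ?_)⟩, rfl⟩
  · have hGζ := ((hG.differentiableOn (by simp)).hasFDerivAt (hΩ.mem_nhds hyΩ)).comp κ
      ((hζ.differentiableOn (by simp)).hasFDerivAt (hV.mem_nhds hκ))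
    refine hGζ.unique ((hasFDerivAt_const (0 : F) κ).congr_of_eventuallyEq ?_)
    filter_upwards [hV.mem_nhds hκ] with κ' hκ' using (hζΩ hκ').2
  · rwa [((hasFDerivAt_fst (p := ζ κ)).comp κ
      ((hζ.differentiableOn (by simp)).hasFDerivAt (hV.mem_nhds hκ))).fderiv] at hsurj

theorem exists_nhds_measure_singularZeros_comp_add_subtype {Ω : Set (B × X)} (hΩ : IsOpen Ω)
    {G : B × X → F} (hG : ContDiffOn ℝ ∞ G Ω) {C : Set X} (hC : IsCompact C) {b : B}
    (hclosure : ∀ x ∈ C, (b, x) ∈ closure (Ω ∩ G ⁻¹' {0}) → (b, x) ∈ Ω)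
    (T : Submodule ℝ B) [FiniteDimensional ℝ T] [MeasurableSpace T] [BorelSpace T] (μ : Measure T)
    [μ.IsAddHaarMeasure]
    (hT : ∀ x ∈ C, (b, x) ∈ closure (Ω ∩ G ⁻¹' {0}) → Function.Surjective
      (((fderiv ℝ G (b, x)).comp (ContinuousLinearMap.inl ℝ B X)).comp T.subtypeL)) :
    ∃ V ∈ 𝓝 (0 : T), μ (V ∩ {t | ∃ x ∈ C, (b + (t : B), x) ∈ singularZeros Ω G}) = 0 := by
  have hι : ContDiff ℝ ∞ (fun z : T × X => (b + (z.1 : B), z.2)) :=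
    (contDiff_const.add (T.subtypeL.contDiff.comp contDiff_fst)).prodMk contDiff_snd
  have hG₁ : ContDiffOn ℝ 1 G Ω := hG.of_le (by simp)
  refine exists_nhds_measure_inter_image_fst_eq_zero μ hC
    (S := (fun z : T × X => (b + (z.1 : B), z.2)) ⁻¹' singularZeros Ω G) fun x hx => ?_
  have h0 : (b + ((0 : T) : B), x) = (b, x) := by simp
  by_cases hz : (b, x) ∈ closure (Ω ∩ G ⁻¹' {0})
  · have hzΩ : (b + ((0 : T) : B), x) ∈ Ω := h0 ▸ hclosure x hx hz
    have hsurj : Function.Surjective ((fderiv ℝ (fun z : T × X => G (b + (z.1 : B), z.2))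
        (0, x)).comp (ContinuousLinearMap.inl ℝ T X)) := by
      rw [fderiv_comp_add_subtype hΩ hG₁ b T hzΩ, h0]
      convert hT x hx hz using 2
      ext v
      simp
    rw [← singularZeros_comp_add_subtype hΩ hG₁ b T]
    exact exists_nhds_measure_image_fst_singularZeros μ (hΩ.preimage hι.continuous)
      (hG.comp hι.contDiffOn fun z hz => hz) (z := (0, x)) hzΩ hsurj
  · refine ⟨(fun z : T × X => (b + (z.1 : B), z.2)) ⁻¹' (closure (Ω ∩ G ⁻¹' {0}))ᶜ,
      hι.continuous.continuousAt.preimage_mem_nhds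
        (isClosed_closure.isOpen_compl.mem_nhds (h0 ▸ hz)), ?_⟩
    convert measure_empty (μ := μ)
    refine image_eq_empty.2 (eq_empty_of_forall_notMem ?_)
    exact fun z hz => hz.1 (subset_closure ⟨hz.2.1, hz.2.2.1⟩)

theorem subset_closure_setOf_forall_notMem_singularZeros {O : Set B} (hO : IsOpen O) {C : Set X}
    (hC : IsCompact C) {Ω : Set (B × X)} (hΩ : IsOpen Ω) {G : B × X → F}
    (hG : ContDiffOn ℝ ∞ G Ω)
    (hclosure : ∀ b ∈ O, ∀ x ∈ C, (b, x) ∈ closure (Ω ∩ G ⁻¹' {0}) → (b, x) ∈ Ω)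
    (hsurj : ∀ z ∈ Ω, G z = 0 →
      Function.Surjective ((fderiv ℝ G z).comp (ContinuousLinearMap.inl ℝ B X))) :
    O ⊆ closure {b ∈ O | ∀ x ∈ C, (b, x) ∉ singularZeros Ω G} := by
  intro b hb
  set K : Set X := C ∩ (fun x => (b, x)) ⁻¹' closure (Ω ∩ G ⁻¹' {0})
  have hK : IsCompact K := hC.inter_right (isClosed_closure.preimage (by fun_prop))
  have hKΩ : ∀ x ∈ K, (b, x) ∈ Ω := fun x hx => hclosure b hb x hx.1 hx.2
  have hK0 : ∀ x ∈ K, G (b, x) = 0 := fun x hx => by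
    have hcont := hG.continuousOn.continuousAt (hΩ.mem_nhds (hKΩ x hx))
    by_contra hne
    obtain ⟨z, hz, hne⟩ :=
      ((mem_closure_iff_frequently.1 hx.2).and_eventually (hcont.eventually_ne hne)).exists
    exact hne hz.2
  obtain ⟨T, hTfin, hT⟩ := exists_finiteDimensional_forall_surjective hK
    (A := fun x => (fderiv ℝ G (b, x)).comp (ContinuousLinearMap.inl ℝ B X))
    (((hG.continuousOn_fderiv_of_isOpen hΩ (by simp)).comp (by fun_prop) hKΩ).clm_comp
      continuousOn_const) fun x hx => hsurj _ (hKΩ x hx) (hK0 x hx)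
  let _ : MeasurableSpace T := borel T
  have : BorelSpace T := ⟨rfl⟩
  have : ProperSpace T := FiniteDimensional.proper_real T
  obtain ⟨V, hV, hVnull⟩ := exists_nhds_measure_singularZeros_comp_add_subtype hΩ hG hC
    (hclosure b hb) T Measure.addHaar fun x hx hz => hT x ⟨hx, hz⟩
  rw [mem_closure_iff_nhds]
  intro N hN
  have hadd : Tendsto (fun t : T => b + (t : B)) (𝓝 0) (𝓝 b) := by
    have : Continuous fun t : T => b + (t : B) := by fun_prop
    simpa only [ZeroMemClass.coe_zero, add_zero] using this.tendsto 0
  have hpos := Measure.measure_pos_of_mem_nhds Measure.addHaar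
    (inter_mem hV (hadd (inter_mem hN (hO.mem_nhds hb))))
  obtain ⟨t, ⟨htV, htN, htO⟩, htreg⟩ := nonempty_of_measure_ne_zero
    ((measure_sdiff_null hVnull).trans_ne hpos.ne')
  exact ⟨b + (t : B), htN, htO, fun x hx hz => htreg ⟨htV, x, hx, hz⟩⟩

end Parametric

section Interpolation

variable {F : Type*} [NormedAddCommGroup F] [NormedSpace ℝ F]

open BoundedContinuousFunction in
/-- The linear functionals on bounded sequences `b` sending `b` to `∑ a, g a x • b a`, as a function
of `x`: it encodes a family of maps with values in `F` depending linearly on `b`. -/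
noncomputable def evalSeries {α : Type*} (F : Type*) [NormedAddCommGroup F] [NormedSpace ℝ F]
    (g : ℕ → α → ℝ) (x : α) : (ℕ →ᵇ F) →L[ℝ] F :=
  ∑' a, g a x • evalCLM ℝ a

open BoundedContinuousFunction in
theorem norm_evalCLM_le (a : ℕ) : ‖(evalCLM ℝ a : (ℕ →ᵇ F) →L[ℝ] F)‖ ≤ 1 :=
  ContinuousLinearMap.opNorm_le_bound _ zero_le_one fun b =>
    (b.norm_coe_le_norm a).trans_eq (one_mul _).symm

theorem evalSeries_apply [CompleteSpace F] {α : Type*} {g : ℕ → α → ℝ} {x : α}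
    (hg : Summable fun a => g a x) (b : BoundedContinuousFunction ℕ F) :
    evalSeries F g x b = ∑' a, g a x • b a := by
  have hsum : Summable fun a =>
      g a x • (BoundedContinuousFunction.evalCLM ℝ a : BoundedContinuousFunction ℕ F →L[ℝ] F) := by
    refine Summable.of_norm_bounded hg.norm fun a => ?_
    rw [norm_smul]
    exact mul_le_of_le_one_right (norm_nonneg _) (norm_evalCLM_le a)
  exact (ContinuousLinearMap.apply ℝ F b).map_tsum hsum

theorem exists_evalSeries_eq [CompleteSpace F] {α : Type*} {g : ℕ → α → ℝ}
    (hg : ∀ x, Summable fun a => g a x) {a : ℕ} {x : α} (hx : g a x ≠ 0) (ξ : F) :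
    ∃ b, evalSeries F g x b = ξ ∧ ∀ y, g a y = 0 → evalSeries F g y b = 0 := by
  set v : F := (g a x)⁻¹ • ξ
  set b : BoundedContinuousFunction ℕ F := .ofNormedAddCommGroupDiscrete (Pi.single a v) ‖v‖
    fun i => by rcases eq_or_ne i a with rfl | h <;> simp [*]
  have hb : ∀ y, evalSeries F g y b = g a y • v := fun y => by
    rw [evalSeries_apply (hg y), tsum_eq_single a fun i hi => ?_]
    · exact congrArg _ (Pi.single_eq_same (M := fun _ => F) a v)
    · exact (congrArg _ (Pi.single_eq_of_ne (M := fun _ => F) hi v)).trans (smul_zero _)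
  exact ⟨b, by rw [hb, smul_inv_smul₀ hx], fun y hy => by rw [hb, hy, zero_smul]⟩

variable {E : Type*} [NormedAddCommGroup E] [NormedSpace ℝ E]

theorem exists_pos_forall_norm_iteratedFDeriv_smul_le {g : ℕ → E → F}
    (hg : ∀ a, ContDiff ℝ ∞ (g a)) (hgc : ∀ a, HasCompactSupport (g a)) :
    ∃ c : ℕ → ℝ, (∀ a, 0 < c a) ∧
      ∀ k a, k ≤ a → ∀ x, ‖iteratedFDeriv ℝ k (c a • g a) x‖ ≤ (1 / 2) ^ a := by
  have hbd : ∀ a k : ℕ, ∃ S, ∀ x, ‖iteratedFDeriv ℝ k (g a) x‖ ≤ S := fun a k =>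
    ((hg a).continuous_iteratedFDeriv (m := k)
      (by exact_mod_cast le_top)).bounded_above_of_compact_support ((hgc a).iteratedFDeriv k)
  choose S hS using hbd
  have hS0 : ∀ a k, 0 ≤ S a k := fun a k => (norm_nonneg _).trans (hS a k 0)
  set Q : ℕ → ℝ := fun a => 1 + ∑ k ∈ Finset.range (a + 1), S a k
  have hQ : ∀ a, 0 < Q a := fun a =>
    add_pos_of_pos_of_nonneg one_pos (Finset.sum_nonneg fun k _ => hS0 a k)
  have hSQ : ∀ k a, k ≤ a → S a k ≤ Q a := fun k a hka =>
    (Finset.single_le_sum (fun k _ => hS0 a k) (Finset.mem_range_succ_iff.2 hka)).trans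
      (le_add_of_nonneg_left zero_le_one)
  refine ⟨fun a => (1 / 2) ^ a / Q a, fun a => div_pos (by positivity) (hQ a),
    fun k a hka x => ?_⟩
  have hk : ContDiffAt ℝ k (g a) x := (hg a).contDiffAt.of_le (by exact_mod_cast le_top)
  rw [iteratedFDeriv_const_smul_apply hk, norm_smul,
    Real.norm_of_nonneg (div_nonneg (by positivity) (hQ a).le), div_mul_eq_mul_div]
  exact div_le_of_le_mul₀ (hQ a).le (by positivity)
    (mul_le_mul_of_nonneg_left ((hS a k x).trans (hSQ k a hka)) (by positivity))

theorem contDiff_evalSeries [CompleteSpace F] {g : ℕ → E → ℝ} (hg : ∀ a, ContDiff ℝ ∞ (g a))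
    (hbound : ∀ k a, k ≤ a → ∀ x, ‖iteratedFDeriv ℝ k (g a) x‖ ≤ (1 / 2) ^ a) :
    ContDiff ℝ ∞ (evalSeries F g) := by
  refine contDiff_tsum_of_eventually (N := ⊤) (v := fun _ a => (1 / 2) ^ a)
    (fun a => (hg a).smul contDiff_const) (fun _ _ => summable_geometric_two) fun k _ => ?_
  rw [Nat.cofinite_eq_atTop]
  filter_upwards [eventually_ge_atTop k] with a hka x
  have h := (ContinuousLinearMap.toSpanSingleton ℝ
    (BoundedContinuousFunction.evalCLM ℝ a : BoundedContinuousFunction ℕ F →L[ℝ] F)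
    ).norm_iteratedFDeriv_comp_left (hg a).contDiffAt (x := x) (n := k) (by exact_mod_cast le_top)
  refine h.trans (mul_le_of_le_one_left (by positivity) ?_ |>.trans (hbound k a hka x))
  rw [ContinuousLinearMap.norm_toSpanSingleton]
  exact norm_evalCLM_le a

variable [FiniteDimensional ℝ E]

theorem exists_seq_contDiff_hasCompactSupport {D : Set E} (hD : IsOpen D)
    (hDb : Bornology.IsBounded D) :
    ∃ g : ℕ → E → ℝ, (∀ a, ContDiff ℝ ∞ (g a)) ∧ (∀ a, HasCompactSupport (g a)) ∧
      (∀ a, Function.support (g a) ⊆ D) ∧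
      ∀ x ∈ D, ∀ U ∈ 𝓝 x, ∃ a, g a x ≠ 0 ∧ Function.support (g a) ⊆ U := by
  have : ProperSpace E := FiniteDimensional.proper_real E
  set 𝒮 : Set (Set E) := insert ∅ {s ∈ TopologicalSpace.countableBasis E | s ⊆ D}
  obtain ⟨s, hs⟩ := (((TopologicalSpace.countable_countableBasis E).mono
    (sep_subset _ fun s => s ⊆ D)).insert ∅).exists_eq_range (insert_nonempty _ _)
  have hsS : ∀ a, s a ∈ 𝒮 := fun a => hs.ge (mem_range_self a)
  have hsD : ∀ a, s a ⊆ D := fun a => (hsS a).elim (fun h => h ▸ empty_subset D) And.right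
  have hsO : ∀ a, IsOpen (s a) := fun a =>
    (hsS a).elim (fun h => h ▸ isOpen_empty) fun h =>
      TopologicalSpace.isOpen_of_mem_countableBasis h.1
  choose g hgs hg _ using fun a => (hsO a).exists_contDiff_support_eq (n := ⊤)
  have hgD : ∀ a, Function.support (g a) ⊆ D := fun a => hgs a ▸ hsD a
  refine ⟨g, hg, fun a => (hDb.subset (hgD a)).isCompact_closure, hgD, fun x hx U hU => ?_⟩
  obtain ⟨t, ht, hxt, htU⟩ := (TopologicalSpace.isBasis_countableBasis E).mem_nhds_iff.1
    (inter_mem (hD.mem_nhds hx) hU)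
  obtain ⟨a, rfl⟩ : t ∈ range s := hs.le (Or.inr ⟨ht, htU.trans inter_subset_left⟩)
  rw [← hgs a] at hxt htU
  exact ⟨a, hxt, htU.trans inter_subset_right⟩

theorem exists_contDiff_interpolating {D : Set E} (hD : IsOpen D) (hDb : Bornology.IsBounded D) :
    ∃ w : E → BoundedContinuousFunction ℕ E →L[ℝ] E, ContDiff ℝ ∞ w ∧ (∀ x ∉ D, w x = 0) ∧
      (∃ M, LipschitzWith M w) ∧
      ∀ x ∈ D, ∀ F : Set E, F.Finite → x ∉ F → ∀ ξ, ∃ b, w x b = ξ ∧ ∀ y ∈ F, w y b = 0 := by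
  have : ProperSpace E := FiniteDimensional.proper_real E
  have : CompleteSpace E := FiniteDimensional.complete ℝ E
  obtain ⟨g₀, hg₀, hg₀c, hg₀D, hbasis⟩ := exists_seq_contDiff_hasCompactSupport hD hDb
  obtain ⟨c, hc, hbound⟩ := exists_pos_forall_norm_iteratedFDeriv_smul_le hg₀ hg₀c
  set g : ℕ → E → ℝ := fun a => c a • g₀ a
  have hg : ∀ a x, g a x = 0 ↔ g₀ a x = 0 := fun a x => smul_eq_zero_iff_right (hc a).ne'
  have hw : ContDiff ℝ ∞ (evalSeries E g) :=
    contDiff_evalSeries (fun a => (hg₀ a).const_smul (c a)) hbound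
  have hwD : ∀ x ∉ D, evalSeries E g x = 0 := fun x hx => by
    have h0 : ∀ a, g a x = 0 := fun a =>
      (hg a x).2 (Function.notMem_support.1 fun h => hx (hg₀D a h))
    simp only [evalSeries, h0, zero_smul, tsum_zero]
  have hwc : HasCompactSupport (evalSeries E g) :=
    HasCompactSupport.intro hDb.isCompact_closure fun x hx => hwD x fun h => hx (subset_closure h)
  refine ⟨evalSeries E g, hw, hwD,
    ContDiff.lipschitzWith_of_hasCompactSupport hwc hw (by simp), fun x hx F hF hxF ξ => ?_⟩
  have hsum : ∀ x, Summable fun a => g a x := fun x =>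
    summable_geometric_two.of_norm_bounded fun a => by
      simpa only [norm_iteratedFDeriv_zero] using hbound 0 a a.zero_le x
  obtain ⟨a, hax, haF⟩ := hbasis x hx Fᶜ (hF.isClosed.isOpen_compl.mem_nhds hxF)
  obtain ⟨b, hbx, hb⟩ := exists_evalSeries_eq hsum (mt (hg a x).1 hax) ξ
  exact ⟨b, hbx, fun y hy => hb y ((hg a y).2 (Function.notMem_support.1 fun h => haF h hy))⟩

end Interpolation

theorem mapsTo_of_injective_of_forall_notMem_eq {α : Type*} {f : α → α} {K t : Set α}
    (hf : Function.Injective f) (hK : ∀ x ∉ K, f x = x) (hKt : K ⊆ t) : MapsTo f t t := by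
  intro x hx
  by_cases hxK : x ∈ K
  · refine hKt (by_contra fun hfx => hfx ?_)
    rwa [hf (hK _ hfx)]
  · rwa [hK x hxK]

section PerturbationOfIdentity

variable {E : Type*} [NormedAddCommGroup E] [NormedSpace ℝ E] [CompleteSpace E]

theorem exists_homeomorph_eq_add_of_lipschitzWith {u : E → E} {c : NNReal} (hu : LipschitzWith c u)
    (hc : c < 1) : ∃ H : E ≃ₜ E, ∀ x, H x = x + u x := by
  have happrox : ApproximatesLinearOn (fun x => x + u x)
      (ContinuousLinearEquiv.refl ℝ E : E →L[ℝ] E) univ c := fun x _ y _ => by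
    simpa [add_sub_add_comm] using hu.norm_sub_le x y
  refine ⟨happrox.toHomeomorph _
    ((subsingleton_or_nontrivial E).imp_right fun _ : Nontrivial E => ?_), fun x => rfl⟩
  have hnorm : ‖((ContinuousLinearEquiv.refl ℝ E).symm : E →L[ℝ] E)‖₊ = 1 :=
    NNReal.eq (ContinuousLinearMap.norm_id (𝕜 := ℝ) (E := E))
  rwa [hnorm, inv_one]

theorem contDiff_homeomorph_symm_of_eq_add {u : E → E} {c : NNReal} (hu : LipschitzWith c u)
    (hc : c < 1) {n : WithTop ℕ∞} (hn : n ≠ 0) (hun : ContDiff ℝ n u) {H : E ≃ₜ E}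
    (hH : ∀ x, H x = x + u x) : ContDiff ℝ n H.symm := by
  have hHn : ContDiff ℝ n H := by
    rw [show ⇑H = fun x => x + u x from funext hH]
    exact contDiff_id.add hun
  refine contDiff_iff_contDiffAt.2 fun y => ?_
  set A : E →L[ℝ] E := fderiv ℝ u (H.symm y)
  have hA : ‖-A‖ < 1 := by
    rw [norm_neg]
    exact (norm_fderiv_le_of_lipschitz ℝ hu).trans_lt (by exact_mod_cast hc)
  obtain ⟨e, he⟩ := isUnit_one_sub_of_norm_lt_one hA
  have hder : HasFDerivAt H ((ContinuousLinearEquiv.unitsEquiv ℝ E e : E ≃L[ℝ] E) : E →L[ℝ] E)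
      (H.symm y) := by
    have heA : ((ContinuousLinearEquiv.unitsEquiv ℝ E e : E ≃L[ℝ] E) : E →L[ℝ] E) =
        ContinuousLinearMap.id ℝ E + A := by
      ext x
      simp [he]
    rw [heA]
    exact ((hasFDerivAt_id _).add (hun.differentiable hn _).hasFDerivAt).congr_of_eventuallyEq
      (Eventually.of_forall hH)
  exact H.toOpenPartialHomeomorph.contDiffAt_symm (mem_univ _) hder hHn.contDiffAt

end PerturbationOfIdentity

section ChartLift

variable {E : Type*} [NormedAddCommGroup E] {L : Type*} [TopologicalSpace L]

open Classical in
/-- The self-map of a manifold which is read as `T` in the chart `e` and fixes the points outside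
the domain of `e`; it is meant for maps `T` which preserve the image of `e`. -/
noncomputable def chartLift (e : OpenPartialHomeomorph L E) (T : E → E) (x : L) : L :=
  if x ∈ e.source then e.symm (T (e x)) else x

theorem chartLift_of_mem {e : OpenPartialHomeomorph L E} {T : E → E} {x : L} (hx : x ∈ e.source) :
    chartLift e T x = e.symm (T (e x)) := if_pos hx

theorem chartLift_of_notMem {e : OpenPartialHomeomorph L E} {T : E → E} {x : L}
    (hx : x ∉ e.source) : chartLift e T x = x := if_neg hx

theorem leftInverse_chartLift {e : OpenPartialHomeomorph L E} {T T' : E → E}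
    (hT : MapsTo T e.target e.target) (h : Function.LeftInverse T' T) :
    Function.LeftInverse (chartLift e T') (chartLift e T) := fun x => by
  by_cases hx : x ∈ e.source
  · have hy := hT (e.map_source hx)
    rw [chartLift_of_mem hx, chartLift_of_mem (e.map_target hy), e.right_inv hy, h, e.left_inv hx]
  · rw [chartLift_of_notMem hx, chartLift_of_notMem hx]

theorem chartLift_eq_self_of_notMem {e : OpenPartialHomeomorph L E} {T : E → E} {K : Set E}
    (hT : ∀ y ∉ K, T y = y) {x : L} (hx : x ∉ e.symm '' K) : chartLift e T x = x := by
  by_cases hxs : x ∈ e.source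
  · rw [chartLift_of_mem hxs, hT _ fun hK => hx ⟨_, hK, e.left_inv hxs⟩, e.left_inv hxs]
  · exact chartLift_of_notMem hxs

variable [NormedSpace ℝ E] [ChartedSpace E L] {e : OpenPartialHomeomorph L E}
  {B : Type*} [NormedAddCommGroup B] [NormedSpace ℝ B]

theorem contMDiffAt_chartLift_of_mem (he : e ∈ IsManifold.maximalAtlas 𝓘(ℝ, E) ∞ L) {T : B → E → E}
    {b : B} {x : L} (hx : x ∈ e.source)
    (hT : ContDiffAt ℝ ∞ (fun z : B × E => T z.1 z.2) (b, e x)) (hTe : T b (e x) ∈ e.target) :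
    ContMDiffAt (𝓘(ℝ, B).prod 𝓘(ℝ, E)) 𝓘(ℝ, E) ∞ (fun z : B × L => chartLift e (T z.1) z.2)
      (b, x) := by
  have hchart : ContMDiffAt (𝓘(ℝ, B).prod 𝓘(ℝ, E)) 𝓘(ℝ, B × E) ∞
      (fun z : B × L => (z.1, e z.2)) (b, x) := by
    rw [modelWithCornersSelf_prod, ← chartedSpaceSelf_prod]
    exact contMDiffAt_fst.prodMk (((contMDiffOn_of_mem_maximalAtlas he).contMDiffAt
      (e.open_source.mem_nhds hx)).comp (b, x) contMDiffAt_snd)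
  have hsymm : ContMDiffAt 𝓘(ℝ, E) 𝓘(ℝ, E) ∞ e.symm (T b (e x)) :=
    (contMDiffOn_symm_of_mem_maximalAtlas he).contMDiffAt (e.open_target.mem_nhds hTe)
  refine (ContMDiffAt.comp (b, x) (g := e.symm) hsymm
    (ContMDiffAt.comp (b, x) hT.contMDiffAt hchart)).congr_of_eventuallyEq ?_
  filter_upwards [(e.open_source.preimage continuous_snd).mem_nhds hx] with z hz
  exact chartLift_of_mem hz

theorem contMDiffOn_chartLift [T2Space L] (he : e ∈ IsManifold.maximalAtlas 𝓘(ℝ, E) ∞ L)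
    {K : Set E} (hK : IsCompact K) (hKe : K ⊆ e.target) {O : Set B} (hO : IsOpen O)
    {T : B → E → E} (hT : ContDiffOn ℝ ∞ (fun z : B × E => T z.1 z.2) (O ×ˢ univ))
    (hTK : ∀ b ∈ O, ∀ x ∉ K, T b x = x) (hTe : ∀ b ∈ O, MapsTo (T b) e.target e.target) :
    ContMDiffOn (𝓘(ℝ, B).prod 𝓘(ℝ, E)) 𝓘(ℝ, E) ∞ (fun z : B × L => chartLift e (T z.1) z.2)
      (O ×ˢ univ) := by
  rintro ⟨b, x⟩ ⟨hb, -⟩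
  refine ContMDiffAt.contMDiffWithinAt ?_
  by_cases hx : x ∈ e.source
  · exact contMDiffAt_chartLift_of_mem he hx
      (hT.contDiffAt ((hO.prod isOpen_univ).mem_nhds ⟨hb, mem_univ _⟩))
      (hTe b hb (e.map_source hx))
  · have hclosed : IsClosed (e.symm '' K) :=
      (hK.image_of_continuousOn (e.continuousOn_symm.mono hKe)).isClosed
    have hxK : x ∉ e.symm '' K := by
      rintro ⟨y, hy, rfl⟩
      exact hx (e.map_target (hKe hy))
    refine contMDiffAt_snd.congr_of_eventuallyEq ?_
    filter_upwards [(hO.prod hclosed.isOpen_compl).mem_nhds (mk_mem_prod hb hxK)] with z hz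
    exact chartLift_eq_self_of_notMem (hTK _ hz.1) hz.2

theorem contMDiff_chartLift [T2Space L] (he : e ∈ IsManifold.maximalAtlas 𝓘(ℝ, E) ∞ L)
    {K : Set E} (hK : IsCompact K) (hKe : K ⊆ e.target) {T : E → E} (hT : ContDiff ℝ ∞ T)
    (hTK : ∀ x ∉ K, T x = x) (hTe : MapsTo T e.target e.target) :
    ContMDiff 𝓘(ℝ, E) 𝓘(ℝ, E) ∞ (chartLift e T) := by
  have hslice : ContMDiff 𝓘(ℝ, E) (𝓘(ℝ, ℝ).prod 𝓘(ℝ, E)) ∞ (fun x : L => ((0 : ℝ), x)) :=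
    contMDiff_const.prodMk contMDiff_id
  exact contMDiffOn_univ.1 ((contMDiffOn_chartLift he hK hKe (T := fun _ : ℝ => T) isOpen_univ
    (hT.comp contDiff_snd).contDiffOn (fun _ _ => hTK) fun _ _ => hTe).comp hslice.contMDiffOn
    fun x _ => ⟨mem_univ _, mem_univ _⟩)

theorem exists_diffeomorph_eq_chartLift [T2Space L]
    (he : e ∈ IsManifold.maximalAtlas 𝓘(ℝ, E) ∞ L) {K : Set E} (hK : IsCompact K)
    (hKe : K ⊆ e.target) {H : E ≃ₜ E} (hH : ContDiff ℝ ∞ H) (hH' : ContDiff ℝ ∞ H.symm)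
    (hHK : ∀ x ∉ K, H x = x) : ∃ ψ : L ≃ₘ⟮𝓘(ℝ, E), 𝓘(ℝ, E)⟯ L, ⇑ψ = chartLift e H := by
  have hHK' : ∀ x ∉ K, H.symm x = x := fun x hx => by rw [H.symm_apply_eq, hHK x hx]
  have hHe := mapsTo_of_injective_of_forall_notMem_eq H.injective hHK hKe
  have hHe' := mapsTo_of_injective_of_forall_notMem_eq H.symm.injective hHK' hKe
  exact ⟨{  toFun := chartLift e H
            invFun := chartLift e H.symm
            left_inv := leftInverse_chartLift hHe H.symm_apply_apply
            right_inv := leftInverse_chartLift hHe' H.apply_symm_apply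
            contMDiff_toFun := contMDiff_chartLift he hK hKe hH hHK hHe
            contMDiff_invFun := contMDiff_chartLift he hK hKe hH' hHK' hHe' }, rfl⟩

end ChartLift

section DiffeomorphFamily

variable (E : Type*) [NormedAddCommGroup E] [NormedSpace ℝ E]
  {L : Type*} [TopologicalSpace L] [ChartedSpace E L]
  {B B₁ B₂ : Type*} [NormedAddCommGroup B] [NormedSpace ℝ B]
  [NormedAddCommGroup B₁] [NormedSpace ℝ B₁] [NormedAddCommGroup B₂] [NormedSpace ℝ B₂]

/-- A family `φ b` of diffeomorphisms of the manifold `L` (modelled on `E`), depending smoothly on a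
parameter `b` in an open neighbourhood `O` of `0` and equal to the identity at `b = 0`. The values
of `φ` at parameters outside `O` are irrelevant. -/
structure IsDiffeomorphFamily (φ : B → L → L) (O : Set B) : Prop where
  isOpen : IsOpen O
  zero_mem : (0 : B) ∈ O
  contMDiffOn : ContMDiffOn (𝓘(ℝ, B).prod 𝓘(ℝ, E)) 𝓘(ℝ, E) ∞ (fun z : B × L => φ z.1 z.2)
    (O ×ˢ univ)
  exists_diffeomorph : ∀ b ∈ O, ∃ ψ : L ≃ₘ⟮𝓘(ℝ, E), 𝓘(ℝ, E)⟯ L, ⇑ψ = φ b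
  zero_apply : ∀ x, φ 0 x = x

/-- The family `φ` moves the points of `S` independently: by varying the parameter, the image of a
point of `S` can be given any velocity, to first order without moving the images of finitely many
other points of `L`. This makes evaluation at any tuple of distinct points submersive in the
parameter. -/
def MovesIndependently (φ : B → L → L) (O : Set B) (S : Set L) : Prop :=
  ∀ b ∈ O, ∀ y ∈ S, ∀ F : Set L, F.Finite → y ∉ F → ∀ ξ : TangentSpace 𝓘(ℝ, E) (φ b y),
    ∃ b' : B, mfderiv 𝓘(ℝ, B) 𝓘(ℝ, E) (fun b => φ b y) b b' = ξ ∧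
      ∀ y' ∈ F, mfderiv 𝓘(ℝ, B) 𝓘(ℝ, E) (fun b => φ b y') b b' = 0

variable {E}

theorem MovesIndependently.mono {φ : B → L → L} {O O' : Set B} {S S' : Set L}
    (h : MovesIndependently E φ O S) (hO : O' ⊆ O) (hS : S' ⊆ S) :
    MovesIndependently E φ O' S' := fun b hb y hy => h b (hO hb) y (hS hy)

theorem MovesIndependently.union {φ : B → L → L} {O : Set B} {S S' : Set L}
    (h : MovesIndependently E φ O S) (h' : MovesIndependently E φ O S') :
    MovesIndependently E φ O (S ∪ S') := fun b hb y hy => hy.elim (h b hb y) (h' b hb y)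

namespace IsDiffeomorphFamily

variable {φ : B → L → L} {O : Set B}

theorem mono (h : IsDiffeomorphFamily E φ O) {O' : Set B} (hO' : IsOpen O') (h0 : (0 : B) ∈ O')
    (hO : O' ⊆ O) : IsDiffeomorphFamily E φ O' where
  isOpen := hO'
  zero_mem := h0
  contMDiffOn := h.contMDiffOn.mono (prod_mono_left hO)
  exists_diffeomorph b hb := h.exists_diffeomorph b (hO hb)
  zero_apply := h.zero_apply

theorem contMDiffAt (h : IsDiffeomorphFamily E φ O) {b : B} (hb : b ∈ O) (y : L) :
    ContMDiffAt (𝓘(ℝ, B).prod 𝓘(ℝ, E)) 𝓘(ℝ, E) ∞ (fun z : B × L => φ z.1 z.2) (b, y) :=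
  h.contMDiffOn.contMDiffAt ((h.isOpen.prod isOpen_univ).mem_nhds (mk_mem_prod hb (mem_univ y)))

theorem contMDiff (h : IsDiffeomorphFamily E φ O) {b : B} (hb : b ∈ O) :
    ContMDiff 𝓘(ℝ, E) 𝓘(ℝ, E) ∞ (φ b) := by
  obtain ⟨ψ, hψ⟩ := h.exists_diffeomorph b hb
  exact hψ ▸ ψ.contMDiff

theorem injective (h : IsDiffeomorphFamily E φ O) {b : B} (hb : b ∈ O) :
    Function.Injective (φ b) := by
  obtain ⟨ψ, hψ⟩ := h.exists_diffeomorph b hb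
  exact hψ ▸ ψ.injective

theorem surjective_mfderiv (h : IsDiffeomorphFamily E φ O) {b : B} (hb : b ∈ O) (y : L) :
    Function.Surjective (mfderiv 𝓘(ℝ, E) 𝓘(ℝ, E) (φ b) y) := by
  obtain ⟨ψ, hψ⟩ := h.exists_diffeomorph b hb
  exact hψ ▸ (ψ.mfderivToContinuousLinearEquiv (by simp) y).surjective

theorem mdifferentiableAt (h : IsDiffeomorphFamily E φ O) {b : B} (hb : b ∈ O) (y : L) :
    MDifferentiableAt 𝓘(ℝ, B) 𝓘(ℝ, E) (fun b => φ b y) b :=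
  (ContMDiffAt.comp b (h.contMDiffAt hb y)
    (contMDiffAt_id.prodMk contMDiffAt_const)).mdifferentiableAt (by simp)

theorem eventually_forall_mem (h : IsDiffeomorphFamily E φ O) {K S : Set L} (hK : IsCompact K)
    (hS : IsOpen S) (hKS : K ⊆ S) : ∀ᶠ b in 𝓝 (0 : B), ∀ y ∈ K, φ b y ∈ S :=
  hK.eventually_forall_of_forall_eventually fun y hy =>
    (h.contMDiffAt h.zero_mem y).continuousAt.preimage_mem_nhds
      (hS.mem_nhds (by simpa only [h.zero_apply] using hKS hy))

variable {φ₁ : B₁ → L → L} {O₁ : Set B₁} {φ₂ : B₂ → L → L} {O₂ : Set B₂}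

theorem comp (h₁ : IsDiffeomorphFamily E φ₁ O₁) (h₂ : IsDiffeomorphFamily E φ₂ O₂) :
    IsDiffeomorphFamily E (fun (b : B₁ × B₂) x => φ₁ b.1 (φ₂ b.2 x)) (O₁ ×ˢ O₂) where
  isOpen := h₁.isOpen.prod h₂.isOpen
  zero_mem := ⟨h₁.zero_mem, h₂.zero_mem⟩
  contMDiffOn := by
    have hfst : ContMDiff (𝓘(ℝ, B₁ × B₂).prod 𝓘(ℝ, E)) 𝓘(ℝ, B₁) ∞
        (fun z : (B₁ × B₂) × L => z.1.1) :=
      (contDiff_fst (𝕜 := ℝ) (E := B₁) (F := B₂)).contMDiff.comp contMDiff_fst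
    have hsnd : ContMDiff (𝓘(ℝ, B₁ × B₂).prod 𝓘(ℝ, E)) 𝓘(ℝ, B₂) ∞
        (fun z : (B₁ × B₂) × L => z.1.2) :=
      (contDiff_snd (𝕜 := ℝ) (E := B₁) (F := B₂)).contMDiff.comp contMDiff_fst
    have hinner : ContMDiffOn (𝓘(ℝ, B₁ × B₂).prod 𝓘(ℝ, E)) 𝓘(ℝ, E) ∞
        (fun z : (B₁ × B₂) × L => φ₂ z.1.2 z.2) ((O₁ ×ˢ O₂) ×ˢ univ) :=
      h₂.contMDiffOn.comp (hsnd.prodMk contMDiff_snd).contMDiffOn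
        fun z hz => ⟨hz.1.2, mem_univ _⟩
    exact h₁.contMDiffOn.comp (hfst.contMDiffOn.prodMk hinner) fun z hz => ⟨hz.1.1, mem_univ _⟩
  exists_diffeomorph := by
    rintro b ⟨hb₁, hb₂⟩
    obtain ⟨ψ₁, hψ₁⟩ := h₁.exists_diffeomorph b.1 hb₁
    obtain ⟨ψ₂, hψ₂⟩ := h₂.exists_diffeomorph b.2 hb₂
    exact ⟨ψ₂.trans ψ₁, by rw [Diffeomorph.coe_trans, hψ₁, hψ₂]; rfl⟩
  zero_apply x := by rw [Prod.fst_zero, Prod.snd_zero, h₂.zero_apply, h₁.zero_apply]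

theorem mfderiv_comp_inl (h₁ : IsDiffeomorphFamily E φ₁ O₁) (h₂ : IsDiffeomorphFamily E φ₂ O₂)
    {b : B₁ × B₂} (hb : b ∈ O₁ ×ˢ O₂) (y : L) (v : B₁) :
    mfderiv 𝓘(ℝ, B₁ × B₂) 𝓘(ℝ, E) (fun b : B₁ × B₂ => φ₁ b.1 (φ₂ b.2 y)) b ((v, 0) : B₁ × B₂) =
      mfderiv 𝓘(ℝ, B₁) 𝓘(ℝ, E) (fun c => φ₁ c (φ₂ b.2 y)) b.1 v := by
  have hinl : HasMFDerivAt 𝓘(ℝ, B₁) 𝓘(ℝ, B₁ × B₂) (fun c => (c, b.2)) b.1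
    (ContinuousLinearMap.inl ℝ B₁ B₂) := (hasFDerivAt_prodMk_left b.1 b.2).hasMFDerivAt
  exact (DFunLike.congr_fun (HasMFDerivAt.comp b.1 (g := fun b : B₁ × B₂ => φ₁ b.1 (φ₂ b.2 y))
    ((h₁.comp h₂).mdifferentiableAt hb y).hasMFDerivAt hinl).mfderiv v).symm

theorem mfderiv_comp_inr (h₁ : IsDiffeomorphFamily E φ₁ O₁) (h₂ : IsDiffeomorphFamily E φ₂ O₂)
    {b : B₁ × B₂} (hb : b ∈ O₁ ×ˢ O₂) (y : L) (v : B₂) :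
    mfderiv 𝓘(ℝ, B₁ × B₂) 𝓘(ℝ, E) (fun b : B₁ × B₂ => φ₁ b.1 (φ₂ b.2 y)) b ((0, v) : B₁ × B₂) =
      mfderiv 𝓘(ℝ, E) 𝓘(ℝ, E) (φ₁ b.1) (φ₂ b.2 y)
        (mfderiv 𝓘(ℝ, B₂) 𝓘(ℝ, E) (fun c => φ₂ c y) b.2 v) := by
  have hinr : HasMFDerivAt 𝓘(ℝ, B₂) 𝓘(ℝ, B₁ × B₂) (fun c => (b.1, c)) b.2
    (ContinuousLinearMap.inr ℝ B₁ B₂) := (hasFDerivAt_prodMk_right b.1 b.2).hasMFDerivAt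
  have hleft := (HasMFDerivAt.comp b.2 (g := fun b : B₁ × B₂ => φ₁ b.1 (φ₂ b.2 y))
    ((h₁.comp h₂).mdifferentiableAt hb y).hasMFDerivAt hinr).mfderiv
  have hright := (HasMFDerivAt.comp b.2
    ((h₁.contMDiff hb.1).mdifferentiable (by simp) (φ₂ b.2 y)).hasMFDerivAt
    (h₂.mdifferentiableAt hb.2 y).hasMFDerivAt).mfderiv
  exact DFunLike.congr_fun (hleft.symm.trans hright) v

theorem movesIndependently_comp_left (h₁ : IsDiffeomorphFamily E φ₁ O₁)
    (h₂ : IsDiffeomorphFamily E φ₂ O₂) {S K : Set L} (hS : MovesIndependently E φ₁ O₁ S)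
    (hK : ∀ b ∈ O₂, ∀ y ∈ K, φ₂ b y ∈ S) :
    MovesIndependently E (fun (b : B₁ × B₂) x => φ₁ b.1 (φ₂ b.2 x)) (O₁ ×ˢ O₂) K := by
  intro b hb y hy F hF hyF ξ
  have hyF' : φ₂ b.2 y ∉ φ₂ b.2 '' F := fun h => hyF ((h₂.injective hb.2).mem_set_image.1 h)
  obtain ⟨v, hv, hvF⟩ := hS b.1 hb.1 _ (hK b.2 hb.2 y hy) _ (hF.image _) hyF' ξ
  exact ⟨(v, 0), (h₁.mfderiv_comp_inl h₂ hb y v).trans hv, fun y' hy' =>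
    (h₁.mfderiv_comp_inl h₂ hb y' v).trans (hvF _ (mem_image_of_mem _ hy'))⟩

theorem movesIndependently_comp_right (h₁ : IsDiffeomorphFamily E φ₁ O₁)
    (h₂ : IsDiffeomorphFamily E φ₂ O₂) {S : Set L} (hS : MovesIndependently E φ₂ O₂ S) :
    MovesIndependently E (fun (b : B₁ × B₂) x => φ₁ b.1 (φ₂ b.2 x)) (O₁ ×ˢ O₂) S := by
  intro b hb y hy F hF hyF ξ
  obtain ⟨η, rfl⟩ := h₁.surjective_mfderiv hb.1 (φ₂ b.2 y) ξ
  obtain ⟨v, rfl, hvF⟩ := hS b.2 hb.2 y hy F hF hyF η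
  exact ⟨(0, v), h₁.mfderiv_comp_inr h₂ hb y v, fun y' hy' =>
    (h₁.mfderiv_comp_inr h₂ hb y' v).trans ((congrArg _ (hvF y' hy')).trans (map_zero _))⟩

theorem exists_movesIndependently_union (h₁ : IsDiffeomorphFamily E φ₁ O₁)
    (h₂ : IsDiffeomorphFamily E φ₂ O₂) {S₁ S₂ K : Set L} (hS₁ : MovesIndependently E φ₁ O₁ S₁)
    (hS₂ : MovesIndependently E φ₂ O₂ S₂) (hS₁o : IsOpen S₁) (hK : IsCompact K) (hKS : K ⊆ S₁) :
    ∃ (φ : B₁ × B₂ → L → L) (O : Set (B₁ × B₂)), IsDiffeomorphFamily E φ O ∧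
      MovesIndependently E φ O (K ∪ S₂) := by
  obtain ⟨V, hV, hVo, hV0⟩ := _root_.mem_nhds_iff.1 (h₂.eventually_forall_mem hK hS₁o hKS)
  have h₂' := h₂.mono (h₂.isOpen.inter hVo) ⟨h₂.zero_mem, hV0⟩ inter_subset_left
  exact ⟨_, _, h₁.comp h₂', (h₁.movesIndependently_comp_left h₂' hS₁ fun b hb => hV hb.2).union
    (h₁.movesIndependently_comp_right h₂' (hS₂.mono inter_subset_left subset_rfl))⟩

end IsDiffeomorphFamily

end DiffeomorphFamily

section ChartPerturbation

variable {E : Type*} [NormedAddCommGroup E] [NormedSpace ℝ E]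
  {L : Type*} [TopologicalSpace L] [ChartedSpace E L] {e : OpenPartialHomeomorph L E}
  {B : Type*} [NormedAddCommGroup B] [NormedSpace ℝ B] {w : E → B →L[ℝ] E} {M : NNReal}

theorem lipschitzWith_clm_apply (hM : LipschitzWith M w) (b : B) :
    LipschitzWith (M * ‖b‖₊) fun x => w x b :=
  lipschitzWith_iff_norm_sub_le.2 fun x y => by
    calc ‖w x b - w y b‖ = ‖(w x - w y) b‖ := rfl
      _ ≤ ‖w x - w y‖ * ‖b‖ := (w x - w y).le_opNorm b
      _ ≤ M * ‖x - y‖ * ‖b‖ := by gcongr; exact hM.norm_sub_le x y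
      _ = (M * ‖b‖₊ : NNReal) * ‖x - y‖ := by push_cast; ring

theorem hasMFDerivAt_chartLift_add (he : e ∈ IsManifold.maximalAtlas 𝓘(ℝ, E) 1 L) {b : B} {y : L}
    (hy : y ∈ e.source) (hTy : e y + w (e y) b ∈ e.target) :
    HasMFDerivAt 𝓘(ℝ, B) 𝓘(ℝ, E) (fun b => chartLift e (fun x => x + w x b) y) b
      ((mfderiv 𝓘(ℝ, E) 𝓘(ℝ, E) e.symm (e y + w (e y) b)).comp (w (e y))) := by
  have hsymm : MDifferentiableAt 𝓘(ℝ, E) 𝓘(ℝ, E) e.symm (e y + w (e y) b) :=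
    ((contMDiffOn_symm_of_mem_maximalAtlas he).contMDiffAt
      (e.open_target.mem_nhds hTy)).mdifferentiableAt one_ne_zero
  exact (HasMFDerivAt.comp b hsymm.hasMFDerivAt
    ((w (e y)).hasFDerivAt.const_add (e y)).hasMFDerivAt).congr_of_eventuallyEq
    (Eventually.of_forall fun b => chartLift_of_mem hy)

variable [CompleteSpace E] {K : Set E}

theorem mapsTo_add_clm_apply (hM : LipschitzWith M w) (hwK : ∀ x ∉ K, w x = 0) {t : Set E}
    (hKt : K ⊆ t) {b : B} (hb : M * ‖b‖₊ < 1) : MapsTo (fun x => x + w x b) t t := by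
  obtain ⟨H, hH⟩ := exists_homeomorph_eq_add_of_lipschitzWith (lipschitzWith_clm_apply hM b) hb
  refine mapsTo_of_injective_of_forall_notMem_eq (K := K) ?_ (fun x hx => ?_) hKt
  · exact (funext hH : ⇑H = _) ▸ H.injective
  · rw [hwK x hx, zero_apply, add_zero]

theorem isDiffeomorphFamily_chartLift [T2Space L] (he : e ∈ IsManifold.maximalAtlas 𝓘(ℝ, E) ∞ L)
    (hK : IsCompact K) (hKe : K ⊆ e.target) (hw : ContDiff ℝ ∞ w) (hM : LipschitzWith M w)
    (hwK : ∀ x ∉ K, w x = 0) :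
    IsDiffeomorphFamily E (fun b => chartLift e fun x => x + w x b) {b | M * ‖b‖₊ < 1} where
  isOpen := isOpen_lt (by fun_prop) continuous_const
  zero_mem := by simp
  contMDiffOn := by
    have hT : ContDiff ℝ ∞ fun z : B × E => z.2 + w z.2 z.1 :=
      contDiff_snd.add ((hw.comp contDiff_snd).clm_apply contDiff_fst)
    exact contMDiffOn_chartLift he hK hKe (T := fun b x => x + w x b)
      (isOpen_lt (by fun_prop) continuous_const) hT.contDiffOn
      (fun b _ x hx => by rw [hwK x hx, zero_apply, add_zero])
      fun b hb => mapsTo_add_clm_apply hM hwK hKe hb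
  exists_diffeomorph b hb := by
    have hLip := lipschitzWith_clm_apply hM b
    have hsmooth : ContDiff ℝ ∞ fun x => w x b := hw.clm_apply contDiff_const
    obtain ⟨H, hH⟩ := exists_homeomorph_eq_add_of_lipschitzWith hLip hb
    have hH' : ⇑H = fun x => x + w x b := funext hH
    rw [← hH']
    exact exists_diffeomorph_eq_chartLift he hK hKe (hH' ▸ contDiff_id.add hsmooth)
      (contDiff_homeomorph_symm_of_eq_add hLip hb (by simp) hsmooth hH)
      fun x hx => by rw [hH, hwK x hx, zero_apply, add_zero]
  zero_apply x := by
    refine chartLift_eq_self_of_notMem (K := ∅) (fun y _ => ?_) (by simp)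
    rw [map_zero, add_zero]

theorem movesIndependently_chartLift [IsManifold 𝓘(ℝ, E) 1 L] (he : e ∈ atlas E L)
    (hKe : K ⊆ e.target) (hM : LipschitzWith M w) (hwK : ∀ x ∉ K, w x = 0) {D : Set E}
    (hwD : ∀ x ∈ D, ∀ F : Set E, F.Finite → x ∉ F → ∀ ξ : E, ∃ b : B, w x b = ξ ∧
      ∀ y ∈ F, w y b = 0) :
    MovesIndependently E (fun b => chartLift e fun x => x + w x b) {b | M * ‖b‖₊ < 1}
      (e.source ∩ e ⁻¹' D) := by
  rintro b hb y ⟨hy, hyD⟩ F hF hyF ξ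
  have hmem : ∀ {y}, y ∈ e.source → e y + w (e y) b ∈ e.target := fun hy =>
    mapsTo_add_clm_apply hM hwK hKe hb (e.map_source hy)
  have hder : ∀ {y}, y ∈ e.source → _ := fun {y} (hy : y ∈ e.source) =>
    (hasMFDerivAt_chartLift_add (IsManifold.subset_maximalAtlas (I := 𝓘(ℝ, E)) he) hy
      (hmem hy)).mfderiv
  have hyF' : e y ∉ e '' (F ∩ e.source) := by
    rintro ⟨y', ⟨hy'F, hy'⟩, heq⟩
    exact hyF (e.injOn hy' hy heq ▸ hy'F)
  obtain ⟨η, hη⟩ := (mdifferentiable_of_mem_atlas he).symm.mfderiv_surjective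
    (I := 𝓘(ℝ, E)) (I' := 𝓘(ℝ, E)) (hmem hy) ξ
  obtain ⟨b', rfl, hb'F⟩ := hwD (e y) hyD _ ((hF.inter_of_left _).image e) hyF' η
  refine ⟨b', (DFunLike.congr_fun (hder hy) b').trans hη, fun y' hy' => ?_⟩
  by_cases hy's : y' ∈ e.source
  · exact (DFunLike.congr_fun (hder hy's) b').trans
      ((congrArg (mfderiv 𝓘(ℝ, E) 𝓘(ℝ, E) e.symm (e y' + w (e y') b))
      (hb'F _ ⟨y', ⟨hy', hy's⟩, rfl⟩)).trans (map_zero _))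
  · have hconst : HasMFDerivAt 𝓘(ℝ, B) 𝓘(ℝ, E)
        (fun b => chartLift e (fun x => x + w x b) y') b 0 :=
      (hasMFDerivAt_const y' b).congr_of_eventuallyEq
        (Eventually.of_forall fun b => chartLift_of_notMem hy's)
    exact DFunLike.congr_fun hconst.mfderiv b'

end ChartPerturbation

section Existence

universe u

variable (E : Type u) [NormedAddCommGroup E] [NormedSpace ℝ E] [FiniteDimensional ℝ E]
  {L : Type*} [TopologicalSpace L] [ChartedSpace E L] [IsManifold 𝓘(ℝ, E) ∞ L] [T2Space L]

theorem exists_nhds_movesIndependently (x₀ : L) : ∃ S ∈ 𝓝 x₀, IsOpen S ∧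
    ∃ (φ : BoundedContinuousFunction ℕ E → L → L) (O : Set _), IsDiffeomorphFamily E φ O ∧
      MovesIndependently E φ O S := by
  have : ProperSpace E := FiniteDimensional.proper_real E
  have : IsManifold 𝓘(ℝ, E) 1 L := IsManifold.of_le (n := ∞) (by simp)
  set e : OpenPartialHomeomorph L E := chartAt E x₀
  obtain ⟨R, hR, hRe⟩ := Metric.nhds_basis_closedBall.mem_iff.1
    (e.open_target.mem_nhds (mem_chart_target E x₀))
  obtain ⟨w, hw, hwD, ⟨M, hM⟩, hint⟩ := exists_contDiff_interpolating (D := Metric.ball (e x₀) R)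
    Metric.isOpen_ball Metric.isBounded_ball
  have hwK : ∀ x ∉ Metric.closedBall (e x₀) R, w x = 0 := fun x hx =>
    hwD x fun h => hx (Metric.ball_subset_closedBall h)
  have hopen : IsOpen (e.source ∩ e ⁻¹' Metric.ball (e x₀) R) :=
    e.isOpen_inter_preimage Metric.isOpen_ball
  exact ⟨_, hopen.mem_nhds ⟨mem_chart_source E x₀, Metric.mem_ball_self hR⟩, hopen, _, _,
    isDiffeomorphFamily_chartLift (IsManifold.chart_mem_maximalAtlas x₀) (isCompact_closedBall _ _)
      hRe hw hM hwK, movesIndependently_chartLift (chart_mem_atlas E x₀) hRe hM hwK hint⟩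

variable (L) in
theorem exists_isDiffeomorphFamily_movesIndependently_univ [CompactSpace L] :
    ∃ (B : Type u) (_ : NormedAddCommGroup B) (_ : NormedSpace ℝ B) (_ : CompleteSpace B)
      (φ : B → L → L) (O : Set B), IsDiffeomorphFamily E φ O ∧
        MovesIndependently E φ O univ := by
  have : CompleteSpace E := FiniteDimensional.complete ℝ E
  let P (S : Set L) : Prop := ∃ (B : Type u) (_ : NormedAddCommGroup B) (_ : NormedSpace ℝ B)
    (_ : CompleteSpace B) (φ : B → L → L) (O : Set B) (S' : Set L), IsOpen S' ∧ closure S ⊆ S' ∧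
      IsDiffeomorphFamily E φ O ∧ MovesIndependently E φ O S'
  have hempty : P ∅ :=
    ⟨E, inferInstance, inferInstance, inferInstance, fun _ x => x, univ, ∅, isOpen_empty,
      by simp, ⟨isOpen_univ, mem_univ _, contMDiffOn_snd, fun _ _ => ⟨Diffeomorph.refl _ _ _, rfl⟩,
      fun _ => rfl⟩, fun _ _ _ hy => hy.elim⟩
  have hmono : ∀ ⦃S T : Set L⦄, S ⊆ T → P T → P S := by
    rintro S T hST ⟨B, i₁, i₂, i₃, φ, O, S', hS'o, hS', hφ⟩
    exact ⟨B, i₁, i₂, i₃, φ, O, S', hS'o, (closure_mono hST).trans hS', hφ⟩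
  have hunion : ∀ ⦃S T : Set L⦄, P S → P T → P (S ∪ T) := by
    rintro S T ⟨B₁, i₁, i₂, i₃, φ₁, O₁, S', hS'o, hS', hφ₁, hS'φ⟩
      ⟨B₂, j₁, j₂, j₃, φ₂, O₂, T', hT'o, hT', hφ₂, hT'φ⟩
    obtain ⟨U, hUo, hSU, hUS'⟩ := normal_exists_closure_subset isClosed_closure hS'o hS'
    obtain ⟨φ, O, hφ, hmoves⟩ := hφ₁.exists_movesIndependently_union hφ₂ hS'φ hT'φ hS'o
      (isClosed_closure (s := U)).isCompact hUS'
    refine ⟨B₁ × B₂, inferInstance, inferInstance, inferInstance, φ, O, U ∪ T', hUo.union hT'o,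
      ?_, hφ, hmoves.mono subset_rfl (union_subset_union_left _ subset_closure)⟩
    rw [closure_union]
    exact union_subset_union hSU hT'
  have hlocal : ∀ x ∈ univ, ∃ t ∈ 𝓝[univ] x, P t := by
    intro x _
    obtain ⟨S, hS, hSo, φ, O, hφ⟩ := exists_nhds_movesIndependently E x
    obtain ⟨t, ht, htc, htS⟩ := exists_mem_nhds_isClosed_subset hS
    exact ⟨t, mem_nhdsWithin_of_mem_nhds ht, _, inferInstance, inferInstance, inferInstance, φ, O,
      S, hSo, by rwa [htc.closure_eq], hφ⟩
  obtain ⟨B, i₁, i₂, i₃, φ, O, S', -, hS', hφ, hmoves⟩ :=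
    (isCompact_univ (X := L)).induction_on (p := P) hempty hmono hunion hlocal
  exact ⟨B, i₁, i₂, i₃, φ, O, hφ, hmoves.mono subset_rfl (subset_closure.trans hS')⟩

end Existence

section SmoothTopologyConvergence

universe u

variable {E : Type u} [NormedAddCommGroup E] [NormedSpace ℝ E]
  {L : Type*} [TopologicalSpace L] [ChartedSpace E L]
  {B : Type*} [NormedAddCommGroup B] [NormedSpace ℝ B]

theorem continuousAt_iteratedFDeriv_slice (k : ℕ) : ∀ {G : Type u} [NormedAddCommGroup G]
    [NormedSpace ℝ G] {H : B × E → G} {z : B × E} (_ : ContDiffAt ℝ k H z),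
    ContinuousAt (fun z : B × E => iteratedFDeriv ℝ k (fun x => H (z.1, x)) z.2) z := by
  induction k with
  | zero =>
    intro G _ _ H z hH
    simp only [iteratedFDeriv_zero_eq_comp]
    exact (LinearIsometryEquiv.continuous _).continuousAt.comp hH.continuousAt
  | succ k ih =>
    intro G _ _ H z hH
    have hderiv : ContDiffAt ℝ k
        (fun z => (fderiv ℝ H z).comp (ContinuousLinearMap.inr ℝ B E)) z :=
      (hH.fderiv_right (by norm_cast)).clm_comp contDiffAt_const
    have hdiff : ∀ᶠ z' in 𝓝 z, ∀ᶠ z'' in 𝓝 z', DifferentiableAt ℝ H z'' :=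
      ((hH.eventually (by simp)).mono fun z' hz' =>
        hz'.differentiableAt (by simp)).eventually_nhds
    simp only [iteratedFDeriv_succ_eq_comp_right]
    refine (LinearIsometryEquiv.continuous _).continuousAt.comp
      ((ih hderiv).congr (hdiff.mono fun z' hz' => ?_))
    refine EventuallyEq.eq_of_nhds (EventuallyEq.iteratedFDeriv (𝕜 := ℝ) ?_ k)
    have hslice : Continuous fun x : E => (z'.1, x) := by fun_prop
    filter_upwards [hslice.continuousAt.eventually hz'] with x hx
    exact (hasFDerivAt_slice_right hx).fderiv.symm

variable {e e' : OpenPartialHomeomorph L E} {x : L}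

theorem contDiffAt_chart_comp_chart_symm (he : e ∈ IsManifold.maximalAtlas 𝓘(ℝ, E) ∞ L)
    (he' : e' ∈ IsManifold.maximalAtlas 𝓘(ℝ, E) ∞ L) {f : L → L}
    (hf : ContMDiffAt 𝓘(ℝ, E) 𝓘(ℝ, E) ∞ f x) (hx : x ∈ e.source) (hfx : f x ∈ e'.source) :
    ContDiffAt ℝ ∞ (e' ∘ f ∘ e.symm) (e x) := by
  have hex : e.symm (e x) = x := e.left_inv hx
  have hsymm : ContMDiffAt 𝓘(ℝ, E) 𝓘(ℝ, E) ∞ e.symm (e x) :=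
    (contMDiffOn_symm_of_mem_maximalAtlas he).contMDiffAt
      (e.open_target.mem_nhds (e.map_source hx))
  have he'f : ContMDiffAt 𝓘(ℝ, E) 𝓘(ℝ, E) ∞ e' (f x) :=
    (contMDiffOn_of_mem_maximalAtlas he').contMDiffAt (e'.open_source.mem_nhds hfx)
  exact (ContMDiffAt.comp_of_eq he'f
    (ContMDiffAt.comp_of_eq hf hsymm hex) (congrArg f hex)).contDiffAt

namespace IsDiffeomorphFamily

variable {φ : B → L → L} {O : Set B}

theorem contDiffAt_chart_comp_chart_symm (h : IsDiffeomorphFamily E φ O)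
    (he : e ∈ IsManifold.maximalAtlas 𝓘(ℝ, E) ∞ L)
    (he' : e' ∈ IsManifold.maximalAtlas 𝓘(ℝ, E) ∞ L) {b : B} (hb : b ∈ O) (hx : x ∈ e.source)
    (hφx : φ b x ∈ e'.source) :
    ContDiffAt ℝ ∞ (fun z : B × E => e' (φ z.1 (e.symm z.2))) (b, e x) := by
  have hex : e.symm (e x) = x := e.left_inv hx
  have hfst : ContMDiffAt 𝓘(ℝ, B × E) 𝓘(ℝ, B) ∞ (fun z : B × E => z.1) (b, e x) :=
    contDiff_fst.contMDiff.contMDiffAt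
  have hsnd : ContMDiffAt 𝓘(ℝ, B × E) 𝓘(ℝ, E) ∞ (fun z : B × E => z.2) (b, e x) :=
    contDiff_snd.contMDiff.contMDiffAt
  have hsymm : ContMDiffAt 𝓘(ℝ, E) 𝓘(ℝ, E) ∞ e.symm (e x) :=
    (contMDiffOn_symm_of_mem_maximalAtlas he).contMDiffAt
      (e.open_target.mem_nhds (e.map_source hx))
  have he'φ : ContMDiffAt 𝓘(ℝ, E) 𝓘(ℝ, E) ∞ e' (φ b x) :=
    (contMDiffOn_of_mem_maximalAtlas he').contMDiffAt (e'.open_source.mem_nhds hφx)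
  have hφe : ContMDiffAt 𝓘(ℝ, B × E) 𝓘(ℝ, E) ∞ (fun z : B × E => φ z.1 (e.symm z.2)) (b, e x) :=
    ContMDiffAt.comp_of_eq (h.contMDiffAt hb x)
      (hfst.prodMk (ContMDiffAt.comp (b, e x) hsymm hsnd)) (Prod.ext rfl hex)
  exact (ContMDiffAt.comp_of_eq he'φ hφe (congrArg (φ b) hex)).contDiffAt

theorem eventually_norm_iteratedFDeriv_sub_lt (h : IsDiffeomorphFamily E φ O) {f : L → L}
    (he : e ∈ IsManifold.maximalAtlas 𝓘(ℝ, E) ∞ L)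
    (he' : e' ∈ IsManifold.maximalAtlas 𝓘(ℝ, E) ∞ L)
    (hf : ContMDiffAt 𝓘(ℝ, E) 𝓘(ℝ, E) ∞ f x) (hx : x ∈ e.source) (hfx : f x ∈ e'.source)
    (hxe' : x ∈ e'.source) (k : ℕ) {ε : ℝ}
    (hε : ‖iteratedFDeriv ℝ k (e' ∘ f ∘ e.symm) (e x) -
      iteratedFDeriv ℝ k (e' ∘ e.symm) (e x)‖ < ε) :
    ∀ᶠ z : B × L in 𝓝 (0, x), ‖iteratedFDeriv ℝ k (e' ∘ f ∘ e.symm) (e z.2) -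
      iteratedFDeriv ℝ k (e' ∘ φ z.1 ∘ e.symm) (e z.2)‖ < ε := by
  have hk : (k : WithTop ℕ∞) ≤ ∞ := by exact_mod_cast le_top
  have hchart : ContinuousAt (fun z : B × L => e z.2) (0, x) :=
    (e.continuousAt hx).comp continuousAt_snd
  have hφ : ContinuousAt (fun z : B × L =>
      iteratedFDeriv ℝ k (e' ∘ φ z.1 ∘ e.symm) (e z.2)) (0, x) :=
    ContinuousAt.comp (f := fun z : B × L => (z.1, e z.2)) (x := ((0 : B), x))
      (continuousAt_iteratedFDeriv_slice k ((h.contDiffAt_chart_comp_chart_symm he he' h.zero_mem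
        hx (by rwa [h.zero_apply])).of_le hk)) (continuousAt_fst.prodMk hchart)
  have hf' : ContinuousAt (fun z : B × L => iteratedFDeriv ℝ k (e' ∘ f ∘ e.symm) (e z.2)) (0, x) :=
    ContinuousAt.comp (f := fun z : B × L => e z.2) (x := ((0 : B), x))
      ((DiffTop.contDiffAt_chart_comp_chart_symm he he' hf hx hfx).iteratedFDeriv_right (i := k)
        (m := 0) (by simpa using hk)).continuousAt hchart
  have hε' : ‖iteratedFDeriv ℝ k (e' ∘ f ∘ e.symm) (e x) -
      iteratedFDeriv ℝ k (e' ∘ φ 0 ∘ e.symm) (e x)‖ < ε := by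
    rwa [show φ 0 = id from funext h.zero_apply]
  exact (hf'.sub hφ).norm.eventually_lt_const hε'

theorem eventually_mem_smoothBasicSet (h : IsDiffeomorphFamily E φ O)
    (f : C^∞⟮𝓘(ℝ, E), L; 𝓘(ℝ, E), L⟯) (he : e ∈ IsManifold.maximalAtlas 𝓘(ℝ, E) ∞ L)
    (he' : e' ∈ IsManifold.maximalAtlas 𝓘(ℝ, E) ∞ L) {K : Set L} (hK : IsCompact K)
    (hKe : K ⊆ e.source) (hf : MapsTo f K e'.source) {r : ℕ} {ε : ℝ}
    (hid : ContMDiffMap.id ∈ smoothBasicSet f e e' K r ε) :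
    ∀ᶠ b in 𝓝 (0 : B), ∀ g : C^∞⟮𝓘(ℝ, E), L; 𝓘(ℝ, E), L⟯, ⇑g = φ b →
      g ∈ smoothBasicSet f e e' K r ε := by
  have hderiv : ∀ᶠ b in 𝓝 (0 : B), ∀ x ∈ K, ∀ k ∈ Finset.range (r + 1),
      ‖iteratedFDeriv ℝ k (e' ∘ f ∘ e.symm) (e x) -
        iteratedFDeriv ℝ k (e' ∘ φ b ∘ e.symm) (e x)‖ < ε :=
    hK.eventually_forall_of_forall_eventually fun x hx => (Finset.eventually_all _).2 fun k hk =>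
      h.eventually_norm_iteratedFDeriv_sub_lt he he' f.contMDiff.contMDiffAt (hKe hx) (hf hx)
        (hid.1 hx) k (hid.2 x hx k (Finset.mem_range_succ_iff.1 hk))
  filter_upwards [h.eventually_forall_mem hK e'.open_source hid.1, hderiv] with b hmaps hb g hg
  refine ⟨fun x hx => ?_, fun x hx k hk => ?_⟩
  · rw [hg]
    exact hmaps x hx
  · rw [hg]
    exact hb x hx k (Finset.mem_range_succ_iff.2 hk)

theorem eventually_mem (h : IsDiffeomorphFamily E φ O) {𝒰 : Set C^∞⟮𝓘(ℝ, E), L; 𝓘(ℝ, E), L⟯}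
    (h𝒰 : IsOpen[smoothTopology L L] 𝒰) (hid : ContMDiffMap.id ∈ 𝒰) :
    ∀ᶠ b in 𝓝 (0 : B), ∀ g : C^∞⟮𝓘(ℝ, E), L; 𝓘(ℝ, E), L⟯, ⇑g = φ b → g ∈ 𝒰 := by
  have hlift : ∀ b, ∃ g : C^∞⟮𝓘(ℝ, E), L; 𝓘(ℝ, E), L⟯, b ∈ O → ⇑g = φ b := fun b => by
    by_cases hb : b ∈ O
    · exact ⟨⟨φ b, h.contMDiff hb⟩, fun _ => rfl⟩
    · exact ⟨ContMDiffMap.id, fun h => absurd h hb⟩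
  choose Φ hΦ using hlift
  have hO : O ∈ 𝓝 (0 : B) := h.isOpen.mem_nhds h.zero_mem
  have hcont : Tendsto Φ (𝓝 0) (@nhds _ (smoothTopology L L) ContMDiffMap.id) := by
    rw [TopologicalSpace.tendsto_nhds_generateFrom_iff]
    rintro W ⟨f, e, e', K, r, ε, he, he', hK, hKe, hf, -, rfl⟩ hW
    filter_upwards [h.eventually_mem_smoothBasicSet f he he' hK hKe hf hW, hO] with b hb hbO
    exact hb _ (hΦ b hbO)
  have h𝒰nhds : 𝒰 ∈ @nhds _ (smoothTopology L L) ContMDiffMap.id :=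
    letI := smoothTopology (E := E) (F := E) L L
    h𝒰.mem_nhds hid
  filter_upwards [hcont h𝒰nhds, hO] with b hb hbO g hg
  rwa [ContMDiffMap.coe_injective (hg.trans (hΦ b hbO).symm)]

end IsDiffeomorphFamily

end SmoothTopologyConvergence

section Pow

variable (E : Type*) [NormedAddCommGroup E] [NormedSpace ℝ E] (s : ℕ)

/-- The model with corners of the power `L^s` of a manifold `L` modelled on `E`. -/
noncomputable abbrev powModel : ModelWithCorners ℝ (Fin s → E) (ModelPi fun _ : Fin s => E) :=
  ModelWithCorners.pi fun _ : Fin s => 𝓘(ℝ, E)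

theorem powModel_boundaryless : (powModel E s).Boundaryless :=
  ⟨range_eq_univ.2 fun x => ⟨x, rfl⟩⟩

variable {E s} {L : Type*} [TopologicalSpace L] [ChartedSpace E L]

theorem isManifold_pow [IsManifold 𝓘(ℝ, E) ∞ L] : IsManifold (powModel E s) ∞ (Fin s → L) := by
  refine isManifold_of_contDiffOn _ _ _ ?_
  rintro _ _ ⟨f, hf, rfl⟩ ⟨g, hg, rfl⟩
  refine contDiffOn_pi.2 fun i => ?_
  have hcompat := (contDiffGroupoid ∞ 𝓘(ℝ, E)).compatible (hf i (mem_univ i)) (hg i (mem_univ i))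
  rw [contDiffGroupoid, mem_groupoid_of_pregroupoid] at hcompat
  have hi : ContDiffOn ℝ ∞ ((f i).symm.trans (g i)) ((f i).symm.trans (g i)).source := by
    simpa [contDiffPregroupoid] using hcompat.1
  exact hi.comp (contDiff_apply ℝ E i).contDiffOn
    fun z hz => ⟨hz.1.1 i (mem_univ i), hz.1.2 i (mem_univ i)⟩

theorem extChartAt_pow_symm_apply_eventuallyEq (q : Fin s → L) (i : Fin s) :
    (fun z => extChartAt 𝓘(ℝ, E) (q i) ((extChartAt (powModel E s) q).symm z i))
      =ᶠ[𝓝[range (powModel E s)] extChartAt (powModel E s) q q] fun z => z i := by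
  filter_upwards [extChartAt_target_mem_nhdsWithin q] with z hz
  exact congrFun ((extChartAt (powModel E s) q).right_inv hz) i

theorem extChartAt_pow_symm_apply_self (q : Fin s → L) (i : Fin s) :
    extChartAt 𝓘(ℝ, E) (q i)
      ((extChartAt (powModel E s) q).symm (extChartAt (powModel E s) q q) i) =
        extChartAt (powModel E s) q q i :=
  congrFun ((extChartAt (powModel E s) q).right_inv (mem_extChartAt_target q)) i

theorem contMDiff_apply_pow (i : Fin s) :
    ContMDiff (powModel E s) 𝓘(ℝ, E) ∞ (fun y : Fin s → L => y i) := fun q =>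
  contMDiffAt_iff.2 ⟨(continuous_apply i).continuousAt,
    (contDiff_apply ℝ E i).contDiffWithinAt.congr_of_eventuallyEq
      (extChartAt_pow_symm_apply_eventuallyEq q i) (extChartAt_pow_symm_apply_self q i)⟩

theorem hasMFDerivAt_apply_pow (i : Fin s) (q : Fin s → L) :
    HasMFDerivAt (powModel E s) 𝓘(ℝ, E) (fun y : Fin s → L => y i) q
      (ContinuousLinearMap.proj (R := ℝ) (φ := fun _ : Fin s => E) i) :=
  ⟨(continuous_apply i).continuousAt,
    (ContinuousLinearMap.proj (R := ℝ) (φ := fun _ : Fin s => E) i).hasFDerivWithinAt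
      |>.congr_of_eventuallyEq (extChartAt_pow_symm_apply_eventuallyEq q i)
        (extChartAt_pow_symm_apply_self q i)⟩

variable {E' H' P : Type*} [NormedAddCommGroup E'] [NormedSpace ℝ E'] [TopologicalSpace H']
  {I : ModelWithCorners ℝ E' H'} [TopologicalSpace P] [ChartedSpace H' P]

theorem contMDiffAt_pow {f : P → Fin s → L} {p : P}
    (h : ∀ i, ContMDiffAt I 𝓘(ℝ, E) ∞ (fun p => f p i) p) :
    ContMDiffAt I (powModel E s) ∞ f p :=
  contMDiffAt_iff_target.2 ⟨continuousAt_pi.2 fun i => (h i).continuousAt,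
    contMDiffAt_pi_space.2 fun i => (contMDiffAt_iff_target.1 (h i)).2⟩

theorem mfderiv_pow_apply {f : P → Fin s → L} {p : P}
    (hf : MDifferentiableAt I (powModel E s) f p) (v : TangentSpace I p) (i : Fin s) :
    (mfderiv I (powModel E s) f p v : Fin s → E) i = mfderiv I 𝓘(ℝ, E) (fun p => f p i) p v :=
  (DFunLike.congr_fun (HasMFDerivAt.comp p (hasMFDerivAt_apply_pow i (f p))
    hf.hasMFDerivAt).mfderiv v).symm

end Pow

section PowMap

theorem injective_of_notMem_bigDiagonal {L : Type*} {s : ℕ} {y : Fin s → L}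
    (hy : y ∉ bigDiagonal L s) : Function.Injective y :=
  fun i j hij => by_contra fun hne => hy ⟨i, j, hne, hij⟩

variable {E : Type*} [NormedAddCommGroup E] [NormedSpace ℝ E] {s : ℕ}
  {L : Type*} [TopologicalSpace L] [ChartedSpace E L]
  {B : Type*} [NormedAddCommGroup B] [NormedSpace ℝ B] {φ : B → L → L} {O : Set B}

theorem MovesIndependently.exists_forall_mfderiv_eq (h : MovesIndependently E φ O univ)
    {b : B} (hb : b ∈ O) {y : Fin s → L} (hy : Function.Injective y)
    (ζ : ∀ i, TangentSpace 𝓘(ℝ, E) (φ b (y i))) :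
    ∃ b' : B, ∀ i, mfderiv 𝓘(ℝ, B) 𝓘(ℝ, E) (fun b => φ b (y i)) b b' = ζ i := by
  choose b' hself hother using fun i =>
    h b hb (y i) (mem_univ _) (y '' {j | j ≠ i}) (toFinite _)
      (by rintro ⟨j, hj, hji⟩; exact hj (hy hji)) (ζ i)
  exact ⟨∑ i, b' i, fun j =>
    (map_sum (mfderiv 𝓘(ℝ, B) 𝓘(ℝ, E) (fun b => φ b (y j)) b) b' Finset.univ).trans
      ((Finset.sum_eq_single j (fun i _ hij => hother i _ ⟨j, hij.symm, rfl⟩)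
        fun hj => absurd (Finset.mem_univ j) hj).trans (hself j))⟩

namespace IsDiffeomorphFamily

theorem contMDiffOn_powMap (h : IsDiffeomorphFamily E φ O)
    {X : Type*} [NormedAddCommGroup X] [NormedSpace ℝ X] {σ : X → Fin s → L} {W : Set X}
    (hW : IsOpen W) (hσ : ContMDiffOn 𝓘(ℝ, X) (powModel E s) ∞ σ W) :
    ContMDiffOn 𝓘(ℝ, B × X) (powModel E s) ∞ (fun z : B × X => powMap s (φ z.1) (σ z.2))
      (O ×ˢ W) := by
  rintro ⟨b, v⟩ ⟨hb, hv⟩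
  refine (contMDiffAt_pow fun i => ?_).contMDiffWithinAt
  have hfst : ContMDiffAt 𝓘(ℝ, B × X) 𝓘(ℝ, B) ∞ (fun z : B × X => z.1) (b, v) :=
    contDiffAt_fst.contMDiffAt
  have hσi : ContMDiffAt 𝓘(ℝ, B × X) 𝓘(ℝ, E) ∞ (fun z : B × X => σ z.2 i) (b, v) :=
    (contMDiff_apply_pow i).contMDiffAt.comp (b, v)
      (ContMDiffAt.comp (b, v) (hσ.contMDiffAt (hW.mem_nhds hv)) contDiffAt_snd.contMDiffAt)
  exact ContMDiffAt.comp (b, v) (g := fun z : B × L => φ z.1 z.2) (h.contMDiffAt hb (σ v i))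
    (hfst.prodMk hσi)

theorem surjective_mfderiv_powMap (h : IsDiffeomorphFamily E φ O)
    (hφ : MovesIndependently E φ O univ) {b : B} (hb : b ∈ O) {y : Fin s → L}
    (hy : Function.Injective y) :
    Function.Surjective
      (mfderiv 𝓘(ℝ, B) (powModel E s) (fun b => powMap s (φ b) y) b) := by
  intro ζ
  obtain ⟨b', hb'⟩ := hφ.exists_forall_mfderiv_eq hb hy ζ
  have hsmooth : ContMDiffAt 𝓘(ℝ, B) (powModel E s) ∞ (fun b => powMap s (φ b) y) b :=
    contMDiffAt_pow fun i => ContMDiffAt.comp b (h.contMDiffAt hb (y i))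
      (contMDiffAt_id.prodMk contMDiffAt_const)
  exact ⟨b', funext fun i =>
    (mfderiv_pow_apply (hsmooth.mdifferentiableAt (by simp)) b' i).trans (hb' i)⟩

end IsDiffeomorphFamily

end PowMap

section TangentVectors

variable {F : Type*} [NormedAddCommGroup F] [NormedSpace ℝ F]
  {H : Type*} [TopologicalSpace H] {J : ModelWithCorners ℝ F H}
  {Q : Type*} [TopologicalSpace Q] [ChartedSpace H Q]
  {V : Type*} [NormedAddCommGroup V] [NormedSpace ℝ V]

theorem mem_tangentVectors {R : Set Q} {x : Q} {γ : ℝ → Q} {ε : ℝ} (hε : 0 < ε)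
    (hγ : ContMDiffOn 𝓘(ℝ, ℝ) J ∞ γ (Ioo (-ε) ε)) (hγR : MapsTo γ (Ioo (-ε) ε) R)
    (h0 : γ 0 = x) {v : F} (hv : mfderiv 𝓘(ℝ, ℝ) J γ 0 (1 : ℝ) = v) :
    (v : TangentSpace J x) ∈ tangentVectors J R x := by
  subst h0 hv
  exact ⟨γ, ε, hε, hγ, hγR, rfl⟩

theorem mfderiv_mem_tangentVectors {R : Set Q} {σ : V → Q} {W : Set V} (hW : IsOpen W)
    (hσ : ContMDiffOn 𝓘(ℝ, V) J ∞ σ W) (hσR : MapsTo σ W R) {v : V} (hv : v ∈ W) (β : V) :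
    mfderiv 𝓘(ℝ, V) J σ v β ∈ tangentVectors J R (σ v) := by
  have hline : ContDiff ℝ ∞ fun t : ℝ => v + t • β := by fun_prop
  have hv0 : v + (0 : ℝ) • β = v := by rw [zero_smul, add_zero]
  obtain ⟨ε, hε, hεW⟩ := Metric.mem_nhds_iff.1
    ((hW.preimage hline.continuous).mem_nhds (x := 0) (by rwa [mem_preimage, hv0]))
  rw [Real.ball_eq_Ioo, zero_sub, zero_add] at hεW
  have hderiv : HasMFDerivAt 𝓘(ℝ, ℝ) 𝓘(ℝ, V) (fun t : ℝ => v + t • β) 0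
      (ContinuousLinearMap.toSpanSingleton ℝ β) :=
    ((ContinuousLinearMap.toSpanSingleton ℝ β).hasFDerivAt.const_add v).hasMFDerivAt
  have hσ' : HasMFDerivAt 𝓘(ℝ, V) J σ (v + (0 : ℝ) • β) (mfderiv 𝓘(ℝ, V) J σ v : V →L[ℝ] F) := by
    rw [hv0]
    exact ((hσ.contMDiffAt (hW.mem_nhds hv)).mdifferentiableAt (by simp)).hasMFDerivAt
  refine mem_tangentVectors hε (hσ.comp hline.contMDiff.contMDiffOn hεW)
    (fun t ht => hσR (hεW ht)) (congrArg σ hv0) ?_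
  exact (DFunLike.congr_fun (HasMFDerivAt.comp (0 : ℝ) hσ' hderiv).mfderiv (1 : ℝ)).trans
    (congrArg (mfderiv 𝓘(ℝ, V) J σ v : V →L[ℝ] F) (one_smul ℝ β))

variable [J.Boundaryless]

theorem IsSubmanifold.exists_parametrization {N : Set Q}
    (hN : IsSubmanifold J N) {y : Q} (hy : y ∈ N) :
    ∃ (V : Submodule ℝ F) (σ : V → Q) (W : Set V) (v : V), IsOpen W ∧ v ∈ W ∧
      ContMDiffOn 𝓘(ℝ, V) J ∞ σ W ∧ MapsTo σ W N ∧ ∀ C ∈ 𝓝 v, σ '' C ∈ 𝓝[N] y := by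
  obtain ⟨k, hk⟩ := hN
  obtain ⟨e, he, hye, V, -, hV⟩ := hk y hy
  have hsource : (e.extend J).source = e.source := e.extend_source
  have hW : IsOpen ((↑) ⁻¹' (e.extend J).target : Set V) :=
    e.isOpen_extend_target.preimage continuous_subtype_val
  refine ⟨V, fun v => (e.extend J).symm v, (↑) ⁻¹' (e.extend J).target,
    ⟨e.extend J y, (hV y hye).1 hy⟩, hW, (e.extend J).map_source (hsource ▸ hye), ?_, ?_, ?_⟩
  · have hsymm : ContMDiffOn 𝓘(ℝ, F) J ∞ (e.extend J).symm (e.extend J).target := by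
      simpa only [e.extend_target'] using contMDiffOn_extend_symm he
    exact hsymm.comp V.subtypeL.contDiff.contMDiff.contMDiffOn fun v hv => hv
  · intro v hv
    refine (hV _ (hsource ▸ (e.extend J).map_target hv)).2 ?_
    rw [(e.extend J).right_inv hv]
    exact v.2
  · intro C hC
    obtain ⟨U, hU, hUC⟩ := (mem_nhds_induced _ _ _).1 hC
    filter_upwards [mem_nhdsWithin_of_mem_nhds (e.open_source.mem_nhds hye),
      mem_nhdsWithin_of_mem_nhds ((e.continuousAt_extend hye).preimage_mem_nhds hU),
      self_mem_nhdsWithin] with z hze hzU hzN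
    exact ⟨⟨e.extend J z, (hV z hze).1 hzN⟩, hUC hzU, (e.extend J).left_inv (hsource ▸ hze)⟩

end TangentVectors

section Chart

variable {F : Type*} [NormedAddCommGroup F] [NormedSpace ℝ F]
  {H : Type*} [TopologicalSpace H] {J : ModelWithCorners ℝ F H}
  {Q : Type*} [TopologicalSpace Q] [ChartedSpace H Q]
  {X : Type*} [NormedAddCommGroup X] [NormedSpace ℝ X]
  {V : Type*} [NormedAddCommGroup V] [NormedSpace ℝ V]

theorem hasFDerivAt_extChartAt_comp [IsManifold J ∞ Q] {g : V → Q} {v : V}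
    (hg : MDifferentiableAt 𝓘(ℝ, V) J g v) {q : Q} (hq : g v ∈ (extChartAt J q).source) :
    HasFDerivAt (fun v => extChartAt J q (g v))
      ((mfderiv J 𝓘(ℝ, F) (extChartAt J q) (g v)).comp (mfderiv 𝓘(ℝ, V) J g v) : V →L[ℝ] F) v := by
  have : IsManifold J 1 Q := IsManifold.of_le (n := ∞) (by simp)
  rw [extChartAt_source] at hq
  exact (HasMFDerivAt.comp v (mdifferentiableAt_extChartAt hq).hasMFDerivAt
    hg.hasMFDerivAt).hasFDerivAt

variable (J) in
/-- Two maps `g : X → Q` and `h : V → Q` from normed spaces to a manifold, with `g x = h v`, are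
transverse at `(x, v)` if the images of their derivatives span the tangent space. The equality
`g x = h v` is not part of the definition: the tangent spaces at `g x` and at `h v` are both
identified with the model space `F`. -/
def TransverseAt (g : X → Q) (h : V → Q) (x : X) (v : V) : Prop :=
  (range (mfderiv 𝓘(ℝ, X) J g x) : Set F) + (range (mfderiv 𝓘(ℝ, V) J h v) : Set F) = univ

theorem transverseAt_of_surjective_hasFDerivAt [IsManifold J ∞ Q] {g : X → Q} {h : V → Q}
    {x : X} {v : V} (hg : MDifferentiableAt 𝓘(ℝ, X) J g x) (hh : MDifferentiableAt 𝓘(ℝ, V) J h v)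
    (hgh : g x = h v) {q : Q} (hq : g x ∈ (extChartAt J q).source) {A : X × V →L[ℝ] F}
    (hA : HasFDerivAt (fun z : X × V => extChartAt J q (g z.1) - extChartAt J q (h z.2)) A (x, v))
    (hsurj : Function.Surjective A) : TransverseAt J g h x v := by
  have : IsManifold J 1 Q := IsManifold.of_le (n := ∞) (by simp)
  set c : F →L[ℝ] F := mfderiv J 𝓘(ℝ, F) (extChartAt J q) (g x) with hc
  set g' : X →L[ℝ] F := mfderiv 𝓘(ℝ, X) J g x
  set h' : V →L[ℝ] F := mfderiv 𝓘(ℝ, V) J h v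
  have hcinj : Function.Injective c := (isInvertible_mfderiv_extChartAt hq).injective
  have hderiv_g : HasFDerivAt (fun x => extChartAt J q (g x)) (c.comp g') x :=
    hasFDerivAt_extChartAt_comp hg hq
  have hderiv_h : HasFDerivAt (fun v => extChartAt J q (h v)) (c.comp h') v := by
    rw [hc, hgh]
    exact hasFDerivAt_extChartAt_comp hh (hgh ▸ hq)
  have hAeq := hA.unique ((HasFDerivAt.comp (f := Prod.fst) (x, v) hderiv_g hasFDerivAt_fst).sub
    (HasFDerivAt.comp (f := Prod.snd) (x, v) hderiv_h hasFDerivAt_snd))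
  refine eq_univ_of_forall fun w => ?_
  obtain ⟨⟨α, β⟩, hαβ⟩ := hsurj (c w)
  refine Set.mem_add.2 ⟨_, ⟨α, rfl⟩, _, ⟨-β, rfl⟩, hcinj ?_⟩
  change c (g' α + h' (-β)) = c w
  rw [← hαβ, hAeq, map_add, map_neg, map_neg, ← sub_eq_add_neg]
  rfl

theorem TransverseAt.range_mfderiv_add_tangentVectors_eq_univ
    {F' : Type*} [NormedAddCommGroup F'] [NormedSpace ℝ F'] {P : Type*} [TopologicalSpace P]
    [ChartedSpace F' P] [IsManifold 𝓘(ℝ, F') ∞ P] {R : Set Q} {f : P → Q} {p₀ p : P}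
    (hp : p ∈ (extChartAt 𝓘(ℝ, F') p₀).source) (hf : MDifferentiableAt 𝓘(ℝ, F') J f p)
    {σ : V → Q} {W : Set V} (hW : IsOpen W) (hσ : ContMDiffOn 𝓘(ℝ, V) J ∞ σ W)
    (hσR : MapsTo σ W R) {v : V} (hv : v ∈ W) (hfσ : f p = σ v)
    (h : TransverseAt J (fun x => f ((extChartAt 𝓘(ℝ, F') p₀).symm x)) σ
      (extChartAt 𝓘(ℝ, F') p₀ p) v) :
    range (mfderiv 𝓘(ℝ, F') J f p) + tangentVectors J R (f p) = univ := by
  set ξ := extChartAt 𝓘(ℝ, F') p₀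
  have hξp : ξ.symm (ξ p) = p := ξ.left_inv hp
  have hξ : MDifferentiableAt 𝓘(ℝ, F') 𝓘(ℝ, F') ξ.symm (ξ p) :=
    ((contMDiffOn_extChartAt_symm (n := ∞) p₀).contMDiffAt
      ((isOpen_extChartAt_target p₀).mem_nhds (ξ.map_source hp))).mdifferentiableAt (by simp)
  have hcomp : HasMFDerivAt 𝓘(ℝ, F') J (fun x => f (ξ.symm x)) (ξ p)
      ((mfderiv 𝓘(ℝ, F') J f p).comp (mfderiv 𝓘(ℝ, F') 𝓘(ℝ, F') ξ.symm (ξ p)) : F' →L[ℝ] F) := by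
    have hf' : HasMFDerivAt 𝓘(ℝ, F') J f (ξ.symm (ξ p))
        (mfderiv 𝓘(ℝ, F') J f p : F' →L[ℝ] F) := by
      rw [hξp]
      exact hf.hasMFDerivAt
    exact HasMFDerivAt.comp (ξ p) hf' hξ.hasMFDerivAt
  refine eq_univ_of_forall fun w => ?_
  obtain ⟨_, ⟨α, rfl⟩, _, ⟨β, rfl⟩, hαβ⟩ := Set.mem_add.1 (eq_univ_iff_forall.1 h w)
  have hβ := mfderiv_mem_tangentVectors hW hσ hσR hv β
  rw [← hfσ] at hβ
  exact Set.mem_add.2 ⟨_, ⟨mfderiv 𝓘(ℝ, F') 𝓘(ℝ, F') ξ.symm (ξ p) α, rfl⟩, _, hβ,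
    (congrArg (· + (mfderiv 𝓘(ℝ, V) J σ v : V →L[ℝ] F) β)
      (DFunLike.congr_fun hcomp.mfderiv α)).symm.trans hαβ⟩

end Chart

section ChartDifference

variable {F : Type*} [NormedAddCommGroup F] [NormedSpace ℝ F]
  {H : Type*} [TopologicalSpace H] {J : ModelWithCorners ℝ F H}
  {Q : Type*} [TopologicalSpace Q] [ChartedSpace H Q] {q : Q}

theorem contDiffOn_extChartAt_sub_extChartAt [IsManifold J ∞ Q] {Z : Type*}
    [NormedAddCommGroup Z] [NormedSpace ℝ Z] {f₁ f₂ : Z → Q} {D : Set Z}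
    (hf₁ : ContMDiffOn 𝓘(ℝ, Z) J ∞ f₁ D) (hf₂ : ContMDiffOn 𝓘(ℝ, Z) J ∞ f₂ D)
    (hD₁ : MapsTo f₁ D (extChartAt J q).source) (hD₂ : MapsTo f₂ D (extChartAt J q).source) :
    ContDiffOn ℝ ∞ (fun z => extChartAt J q (f₁ z) - extChartAt J q (f₂ z)) D := by
  have hχ : ContMDiffOn J 𝓘(ℝ, F) ∞ (extChartAt J q) (extChartAt J q).source := by
    rw [extChartAt_source]
    exact contMDiffOn_extChartAt
  exact (contMDiffOn_iff_contDiffOn.1 (hχ.comp hf₁ hD₁)).sub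
    (contMDiffOn_iff_contDiffOn.1 (hχ.comp hf₂ hD₂))

theorem mem_of_mem_closure_extChartAt_eq [T2Space Q] {Z : Type*} [TopologicalSpace Z]
    {f₁ f₂ : Z → Q} {D : Set Z} (hD : IsOpen D) (hf₁ : ContinuousOn f₁ D) (hf₂ : ContinuousOn f₂ D)
    (hD₁ : MapsTo f₁ D (extChartAt J q).source) {z : Z} (hzD : z ∈ D)
    (hz : z ∈ closure (D ∩ f₂ ⁻¹' (extChartAt J q).source ∩
      (fun z => extChartAt J q (f₁ z) - extChartAt J q (f₂ z)) ⁻¹' {0})) :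
    z ∈ D ∩ f₂ ⁻¹' (extChartAt J q).source := by
  have hfreq : ∃ᶠ z in 𝓝 z, f₁ z = f₂ z := (mem_closure_iff_frequently.1 hz).mono
    fun z ⟨⟨hzD, hz₂⟩, hz₀⟩ => (extChartAt J q).injOn (hD₁ hzD) hz₂ (sub_eq_zero.1 hz₀)
  have heq : f₁ z = f₂ z := tendsto_nhds_unique_of_frequently_eq
    (hf₁.continuousAt (hD.mem_nhds hzD)) (hf₂.continuousAt (hD.mem_nhds hzD)) hfreq
  exact ⟨hzD, show f₂ z ∈ _ from heq ▸ hD₁ hzD⟩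

end ChartDifference

section ParametricTransversality

variable {F : Type*} [NormedAddCommGroup F] [NormedSpace ℝ F]
  {H : Type*} [TopologicalSpace H] {J : ModelWithCorners ℝ F H}
  {Q : Type*} [TopologicalSpace Q] [ChartedSpace H Q]
  {B : Type*} [NormedAddCommGroup B] [NormedSpace ℝ B]
  {X : Type*} [NormedAddCommGroup X] [NormedSpace ℝ X]
  {V : Type*} [NormedAddCommGroup V] [NormedSpace ℝ V]
  {q : Q} {g : X → Q} {Ψ : B × V → Q}

theorem mdifferentiableAt_slice_left {O : Set B} {W : Set V} (hO : IsOpen O) (hW : IsOpen W)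
    (hΨ : ContMDiffOn 𝓘(ℝ, B × V) J ∞ Ψ (O ×ˢ W)) {b : B} (hb : b ∈ O) {v : V} (hv : v ∈ W) :
    MDifferentiableAt 𝓘(ℝ, B) J (fun b => Ψ (b, v)) b :=
  (ContMDiffAt.comp b (hΨ.contMDiffAt ((hO.prod hW).mem_nhds ⟨hb, hv⟩))
    (contDiffAt_id.prodMk contDiffAt_const).contMDiffAt).mdifferentiableAt (by simp)

theorem mdifferentiableAt_slice_right {O : Set B} {W : Set V} (hO : IsOpen O) (hW : IsOpen W)
    (hΨ : ContMDiffOn 𝓘(ℝ, B × V) J ∞ Ψ (O ×ˢ W)) {b : B} (hb : b ∈ O) {v : V} (hv : v ∈ W) :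
    MDifferentiableAt 𝓘(ℝ, V) J (fun v => Ψ (b, v)) v :=
  (ContMDiffAt.comp v (hΨ.contMDiffAt ((hO.prod hW).mem_nhds ⟨hb, hv⟩))
    (contDiffAt_const.prodMk contDiffAt_id).contMDiffAt).mdifferentiableAt (by simp)

theorem surjective_fderiv_comp_inl_of_surjective_mfderiv [IsManifold J ∞ Q] {b : B} {x : X} {v : V}
    (hq : Ψ (b, v) ∈ (extChartAt J q).source)
    (hΨ : MDifferentiableAt 𝓘(ℝ, B) J (fun b => Ψ (b, v)) b)
    (hsurj : Function.Surjective (mfderiv 𝓘(ℝ, B) J (fun b => Ψ (b, v)) b))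
    (hG : DifferentiableAt ℝ (fun z : B × (X × V) =>
      extChartAt J q (g z.2.1) - extChartAt J q (Ψ (z.1, z.2.2))) (b, (x, v))) :
    Function.Surjective ((fderiv ℝ (fun z : B × (X × V) =>
      extChartAt J q (g z.2.1) - extChartAt J q (Ψ (z.1, z.2.2))) (b, (x, v))).comp
        (ContinuousLinearMap.inl ℝ B (X × V))) := by
  have : IsManifold J 1 Q := IsManifold.of_le (n := ∞) (by simp)
  rw [(hasFDerivAt_slice_left hG).unique
    ((hasFDerivAt_extChartAt_comp hΨ hq).const_sub (extChartAt J q (g x)))]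
  intro w
  obtain ⟨ξ, hξ⟩ := (isInvertible_mfderiv_extChartAt hq).surjective (-w)
  obtain ⟨β, rfl⟩ := hsurj ξ
  exact ⟨β, neg_eq_iff_eq_neg.2 hξ⟩

variable [IsManifold J ∞ Q] [T2Space Q] [FiniteDimensional ℝ F] [FiniteDimensional ℝ X]
  [FiniteDimensional ℝ V] {O : Set B} {U C₁ : Set X} {W C₂ : Set V}

theorem exists_isOpen_dense_transverseAt (hO : IsOpen O) (hU : IsOpen U) (hW : IsOpen W)
    (hg : ContMDiffOn 𝓘(ℝ, X) J ∞ g U) (hgq : MapsTo g U (extChartAt J q).source)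
    (hΨ : ContMDiffOn 𝓘(ℝ, B × V) J ∞ Ψ (O ×ˢ W))
    (hsurj : ∀ b ∈ O, ∀ v ∈ W, Function.Surjective (mfderiv 𝓘(ℝ, B) J (fun b => Ψ (b, v)) b))
    (hC₁ : IsCompact C₁) (hC₁U : C₁ ⊆ U) (hC₂ : IsCompact C₂) (hC₂W : C₂ ⊆ W) :
    ∃ A ⊆ O, IsOpen A ∧ O ⊆ closure A ∧ ∀ b ∈ A, ∀ x ∈ C₁, ∀ v ∈ C₂, g x = Ψ (b, v) →
      TransverseAt J g (fun v => Ψ (b, v)) x v := by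
  set D : Set (B × (X × V)) := O ×ˢ (U ×ˢ W)
  have hD : IsOpen D := hO.prod (hU.prod hW)
  have hf₁ : ContMDiffOn 𝓘(ℝ, B × (X × V)) J ∞ (fun z => g z.2.1) D :=
    hg.comp (contDiff_fst.comp contDiff_snd).contMDiff.contMDiffOn fun z hz => hz.2.1
  have hf₂ : ContMDiffOn 𝓘(ℝ, B × (X × V)) J ∞ (fun z => Ψ (z.1, z.2.2)) D :=
    hΨ.comp (contDiff_fst.prodMk (contDiff_snd.comp contDiff_snd)).contMDiff.contMDiffOn
      fun z hz => ⟨hz.1, hz.2.2⟩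
  have hD₁ : MapsTo (fun z : B × (X × V) => g z.2.1) D (extChartAt J q).source :=
    fun z hz => hgq hz.2.1
  set Ω := D ∩ (fun z => Ψ (z.1, z.2.2)) ⁻¹' (extChartAt J q).source
  have hΩ : IsOpen Ω := hf₂.continuousOn.isOpen_inter_preimage hD (isOpen_extChartAt_source q)
  set G : B × (X × V) → F := fun z => extChartAt J q (g z.2.1) - extChartAt J q (Ψ (z.1, z.2.2))
  have hG : ContDiffOn ℝ ∞ G Ω := contDiffOn_extChartAt_sub_extChartAt
    (hf₁.mono inter_subset_left) (hf₂.mono inter_subset_left)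
    (fun z hz => hD₁ hz.1) fun z hz => hz.2
  have hdiff : ∀ z ∈ Ω, DifferentiableAt ℝ G z := fun z hz =>
    (hG.contDiffAt (hΩ.mem_nhds hz)).differentiableAt (by simp)
  have hclosure : ∀ b ∈ O, ∀ x ∈ C₁ ×ˢ C₂, (b, x) ∈ closure (Ω ∩ G ⁻¹' {0}) → (b, x) ∈ Ω :=
    fun b hb x hx => mem_of_mem_closure_extChartAt_eq hD hf₁.continuousOn hf₂.continuousOn hD₁
      ⟨hb, hC₁U hx.1, hC₂W hx.2⟩
  have hsurjG : ∀ z ∈ Ω, G z = 0 →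
      Function.Surjective ((fderiv ℝ G z).comp (ContinuousLinearMap.inl ℝ B (X × V))) :=
    fun z ⟨⟨hzO, hzUW⟩, hzq⟩ _ => surjective_fderiv_comp_inl_of_surjective_mfderiv hzq
      (mdifferentiableAt_slice_left hO hW hΨ hzO hzUW.2) (hsurj _ hzO _ hzUW.2)
      (hdiff z ⟨⟨hzO, hzUW⟩, hzq⟩)
  refine ⟨{b ∈ O | ∀ x ∈ C₁ ×ˢ C₂, (b, x) ∉ singularZeros Ω G}, sep_subset _ _,
    isOpen_setOf_forall_notMem_singularZeros hO (hC₁.prod hC₂) hΩ (hG.of_le (by simp)) hclosure,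
    subset_closure_setOf_forall_notMem_singularZeros hO (hC₁.prod hC₂) hΩ hG hclosure hsurjG,
    ?_⟩
  rintro b ⟨hb, hreg⟩ x hx v hv hgΨ
  have hzD : (b, (x, v)) ∈ D := ⟨hb, hC₁U hx, hC₂W hv⟩
  have hzΩ : (b, (x, v)) ∈ Ω :=
    ⟨hzD, (congrArg (· ∈ (extChartAt J q).source) hgΨ).mp (hD₁ hzD)⟩
  refine transverseAt_of_surjective_hasFDerivAt
    ((hg.contMDiffAt (hU.mem_nhds (hC₁U hx))).mdifferentiableAt (by simp))
    (mdifferentiableAt_slice_right hO hW hΨ hb (hC₂W hv)) hgΨ (hD₁ hzD)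
    (hasFDerivAt_slice_right (hdiff _ hzΩ)) ?_
  exact by_contra fun hns => hreg _ ⟨hx, hv⟩ ⟨hzΩ, sub_eq_zero.2 (congrArg _ hgΨ), hns⟩

end ParametricTransversality

section PowTransversality

variable {E : Type*} [NormedAddCommGroup E] [NormedSpace ℝ E] {s : ℕ}
  {L : Type*} [TopologicalSpace L] [ChartedSpace E L]
  {B : Type*} [NormedAddCommGroup B] [NormedSpace ℝ B] {φ : B → L → L} {O : Set B}
  {E' : Type*} [NormedAddCommGroup E'] [NormedSpace ℝ E']
  {P : Type*} [TopologicalSpace P] [ChartedSpace E' P]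
  {f : P → Fin s → L} {N : Set (Fin s → L)}

theorem IsDiffeomorphFamily.exists_isOpen_dense_transverse [IsManifold 𝓘(ℝ, E) ∞ L]
    [FiniteDimensional ℝ E] [T2Space L] [FiniteDimensional ℝ E'] [IsManifold 𝓘(ℝ, E') ∞ P]
    (h : IsDiffeomorphFamily E φ O) (hφ : MovesIndependently E φ O univ)
    (hf : ContMDiff 𝓘(ℝ, E') (powModel E s) ∞ f) (hN : IsSubmanifold (powModel E s) N)
    (hNd : N ⊆ (bigDiagonal L s)ᶜ) (p₀ : P) {y₀ : Fin s → L} (hy₀ : y₀ ∈ N) :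
    ∃ A ⊆ O, IsOpen A ∧ O ⊆ closure A ∧ ∃ S ∈ 𝓝[univ ×ˢ N] (p₀, y₀), ∀ b ∈ A, ∀ z ∈ S,
      f z.1 = powMap s (φ b) z.2 →
        range (mfderiv 𝓘(ℝ, E') (powModel E s) f z.1) +
          tangentVectors (powModel E s) (powMap s (φ b) '' N) (f z.1) = univ := by
  have : IsManifold (powModel E s) ∞ (Fin s → L) := isManifold_pow
  have : (powModel E s).Boundaryless := powModel_boundaryless E s
  have : ProperSpace E' := FiniteDimensional.proper_real E'
  obtain ⟨V, σ, W, v₀, hW, hv₀, hσ, hσN, hσ_nhds⟩ := hN.exists_parametrization hy₀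
  have : ProperSpace V := FiniteDimensional.proper_real V
  set ξ := extChartAt 𝓘(ℝ, E') p₀
  set χ := extChartAt (powModel E s) (f p₀)
  have hg : ContMDiffOn 𝓘(ℝ, E') (powModel E s) ∞ (fun x => f (ξ.symm x)) ξ.target :=
    hf.comp_contMDiffOn (contMDiffOn_extChartAt_symm p₀)
  set U : Set E' := ξ.target ∩ (fun x => f (ξ.symm x)) ⁻¹' χ.source
  have hU : IsOpen U := hg.continuousOn.isOpen_inter_preimage (isOpen_extChartAt_target p₀)
    (isOpen_extChartAt_source _)
  have hp₀ : ξ p₀ ∈ U := by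
    refine ⟨mem_extChartAt_target p₀, ?_⟩
    rw [mem_preimage, extChartAt_to_inv]
    exact mem_extChartAt_source _
  obtain ⟨C₁, hC₁, hpC₁, hC₁U⟩ := exists_compact_subset hU hp₀
  obtain ⟨C₂, hC₂, hvC₂, hC₂W⟩ := exists_compact_subset hW hv₀
  obtain ⟨A, hAO, hA, hA_dense, htrans⟩ := exists_isOpen_dense_transverseAt h.isOpen hU hW
    (hg.mono inter_subset_left) (fun x hx => hx.2) (h.contMDiffOn_powMap hW hσ)
    (fun b hb v hv => h.surjective_mfderiv_powMap hφ hb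
      (injective_of_notMem_bigDiagonal (hNd (hσN hv)))) hC₁ hC₁U hC₂ hC₂W
  refine ⟨A, hAO, hA, hA_dense, (ξ.source ∩ ξ ⁻¹' C₁) ×ˢ (σ '' C₂), ?_, ?_⟩
  · rw [nhdsWithin_prod_eq, nhdsWithin_univ]
    exact Filter.prod_mem_prod (inter_mem (extChartAt_source_mem_nhds p₀)
      ((continuousAt_extChartAt p₀).preimage_mem_nhds (mem_interior_iff_mem_nhds.1 hpC₁)))
      (hσ_nhds C₂ (mem_interior_iff_mem_nhds.1 hvC₂))
  · rintro b hbA ⟨p, _⟩ ⟨⟨hp, hpC⟩, v, hv, rfl⟩ hfp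
    have hσb : ContMDiffOn 𝓘(ℝ, V) (powModel E s) ∞ (fun v => powMap s (φ b) (σ v)) W :=
      (h.contMDiffOn_powMap hW hσ).comp
        (contDiff_const.prodMk contDiff_id).contMDiff.contMDiffOn fun v hv => ⟨hAO hbA, hv⟩
    have hgσ : f (ξ.symm (ξ p)) = powMap s (φ b) (σ v) := by rw [ξ.left_inv hp, hfp]
    exact (htrans b hbA _ hpC v hv hgσ).range_mfderiv_add_tangentVectors_eq_univ hp
      (hf.mdifferentiable (by simp) p) hW hσb (fun v hv => mem_image_of_mem _ (hσN hv))
      (hC₂W hv) hfp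

end PowTransversality

theorem exists_mem_inter_of_subset_closure {X ι : Type*} [TopologicalSpace X] [BaireSpace X]
    [Countable ι] {O V : Set X} (hO : IsOpen O) (hV : IsOpen V) (hOV : (O ∩ V).Nonempty)
    {A : ι → Set X} (hA : ∀ i, IsOpen (A i)) (hA_dense : ∀ i, O ⊆ closure (A i)) :
    ∃ x ∈ O ∩ V, ∀ i, x ∈ A i := by
  have hdense : Dense (⋂ i, A i ∪ (closure O)ᶜ) := by
    refine dense_iInter_of_isOpen (fun i => (hA i).union isClosed_closure.isOpen_compl)
      fun i x => ?_
    by_cases hx : x ∈ closure O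
    · exact closure_mono subset_union_left (closure_minimal (hA_dense i) isClosed_closure hx)
    · exact subset_closure (Or.inr hx)
  obtain ⟨x, hxOV, hx⟩ := hdense.inter_open_nonempty (O ∩ V) (hO.inter hV) hOV
  exact ⟨x, hxOV, fun i =>
    (mem_iInter.1 hx i).resolve_right (not_not_intro (subset_closure hxOV.1))⟩

theorem IsDiffeomorphFamily.exists_countable_isTransverse
    {E : Type*} [NormedAddCommGroup E] [NormedSpace ℝ E] [FiniteDimensional ℝ E]
    {L : Type*} [TopologicalSpace L] [ChartedSpace E L] [IsManifold 𝓘(ℝ, E) ∞ L] [T2Space L]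
    [SecondCountableTopology L]
    {B : Type*} [NormedAddCommGroup B] [NormedSpace ℝ B] {φ : B → L → L} {O : Set B}
    {E' : Type*} [NormedAddCommGroup E'] [NormedSpace ℝ E'] [FiniteDimensional ℝ E']
    {P : Type*} [TopologicalSpace P] [ChartedSpace E' P] [IsManifold 𝓘(ℝ, E') ∞ P]
    [SecondCountableTopology P] {s : ℕ} {f : P → Fin s → L} {N : Set (Fin s → L)}
    (h : IsDiffeomorphFamily E φ O) (hφ : MovesIndependently E φ O univ)
    (hf : ContMDiff 𝓘(ℝ, E') (powModel E s) ∞ f) (hN : IsSubmanifold (powModel E s) N)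
    (hNd : N ⊆ (bigDiagonal L s)ᶜ) :
    ∃ 𝒜 : Set (Set B), 𝒜.Countable ∧ (∀ A ∈ 𝒜, IsOpen A ∧ O ⊆ closure A) ∧
      ∀ b, (∀ A ∈ 𝒜, b ∈ A) → IsTransverse (powModel E s) 𝓘(ℝ, E') f (powMap s (φ b) '' N) := by
  have hlocal : ∀ z ∈ (univ : Set P) ×ˢ N, _ := fun z hz =>
    h.exists_isOpen_dense_transverse hφ hf hN hNd z.1 hz.2
  choose! A _ hA hA_dense S hS htrans using hlocal
  obtain ⟨c, hcN, hc, hcover⟩ := TopologicalSpace.countable_cover_nhdsWithin hS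
  refine ⟨A '' c, hc.image A, forall_mem_image.2 fun z hz => ⟨hA z (hcN hz), hA_dense z (hcN hz)⟩,
    ?_⟩
  rintro b hb p ⟨y, hy, hpy⟩
  obtain ⟨z, hzc, hz⟩ := mem_iUnion₂.1 (hcover (mk_mem_prod (mem_univ p) hy))
  exact htrans z (hcN hzc) b (hb _ (mem_image_of_mem A hzc)) (p, y) hz hpy.symm

end DiffTop


theorem mainTheorem10_general
    {E : Type*} [NormedAddCommGroup E] [NormedSpace ℝ E] [FiniteDimensional ℝ E]
    {L : Type*} [TopologicalSpace L] [ChartedSpace E L] [IsManifold 𝓘(ℝ, E) ∞ L]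
    [CompactSpace L] [T2Space L] {ι : Type*} [Countable ι]
    {E' : ι → Type*} [∀ j, NormedAddCommGroup (E' j)] [∀ j, NormedSpace ℝ (E' j)]
    [∀ j, FiniteDimensional ℝ (E' j)]
    {M : ι → Type*} [∀ j, TopologicalSpace (M j)] [∀ j, ChartedSpace (E' j) (M j)]
    [∀ j, IsManifold 𝓘(ℝ, E' j) ∞ (M j)] [∀ j, SecondCountableTopology (M j)]
    {s : ι → ℕ} {N : ∀ j, Set (Fin (s j) → L)}
    (hN : ∀ j, DiffTop.IsSubmanifold (ModelWithCorners.pi fun _ : Fin (s j) => 𝓘(ℝ, E)) (N j))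
    (hNdiag : ∀ j, N j ⊆ (DiffTop.bigDiagonal L (s j))ᶜ)
    {f : ∀ j, M j → Fin (s j) → L}
    (hf : ∀ j, ContMDiff 𝓘(ℝ, E' j) (ModelWithCorners.pi fun _ : Fin (s j) => 𝓘(ℝ, E)) ∞ (f j))
    {𝒰 : Set C^∞⟮𝓘(ℝ, E), L; 𝓘(ℝ, E), L⟯} (h𝒰 : IsOpen[DiffTop.smoothTopology L L] 𝒰)
    (hid : ContMDiffMap.id ∈ 𝒰) :
    ∃ φ : L ≃ₘ⟮𝓘(ℝ, E), 𝓘(ℝ, E)⟯ L, φ.toContMDiffMap ∈ 𝒰 ∧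
      ∀ j, DiffTop.IsTransverse (ModelWithCorners.pi fun _ : Fin (s j) => 𝓘(ℝ, E)) 𝓘(ℝ, E' j)
        (f j) (DiffTop.powMap (s j) φ '' N j) := by
  have : SecondCountableTopology L := ChartedSpace.secondCountable_of_sigmaCompact E L
  obtain ⟨B, _, _, _, φ, O, h, hφ⟩ :=
    DiffTop.exists_isDiffeomorphFamily_movesIndependently_univ E L
  choose 𝒜 h𝒜 hA htrans using fun j =>
    h.exists_countable_isTransverse hφ (hf j) (hN j) (hNdiag j)
  have : ∀ j, Countable (𝒜 j) := fun j => (h𝒜 j).to_subtype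
  obtain ⟨V, hV𝒰, hV, hV0⟩ := _root_.mem_nhds_iff.1 (h.eventually_mem h𝒰 hid)
  obtain ⟨b, ⟨hbO, hbV⟩, hb⟩ := DiffTop.exists_mem_inter_of_subset_closure h.isOpen hV
    ⟨0, h.zero_mem, hV0⟩ (A := fun A : Σ j, 𝒜 j => A.2.1)
    (fun A => (hA A.1 A.2 A.2.2).1) (fun A => (hA A.1 A.2 A.2.2).2)
  obtain ⟨ψ, hψ⟩ := h.exists_diffeomorph b hbO
  refine ⟨ψ, hV𝒰 hbV _ hψ, fun j => ?_⟩
  rw [hψ]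
  exact htrans j b fun A hAj => hb ⟨j, A, hAj⟩

theorem mainTheorem10
    (n : ℕ) {L : Type*} [TopologicalSpace L] [ChartedSpace (EuclideanSpace ℝ (Fin n)) L]
    [IsManifold (𝓡 n) ∞ L] [CompactSpace L] [T2Space L]
    {ι : Type*} [Countable ι]
    (m : ι → ℕ) (M : ι → Type*) [∀ j, TopologicalSpace (M j)]
    [∀ j, ChartedSpace (EuclideanSpace ℝ (Fin (m j))) (M j)]
    [∀ j, IsManifold (𝓡 (m j)) ∞ (M j)]
    [∀ j, T2Space (M j)] [∀ j, SecondCountableTopology (M j)]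
    (s : ι → ℕ) (hs : ∀ j, 0 < s j)
    (N : ∀ j, Set (Fin (s j) → L))
    (hN : ∀ j, DiffTop.IsSubmanifold (ModelWithCorners.pi fun _ : Fin (s j) => 𝓡 n) (N j))
    (hNdiag : ∀ j, N j ⊆ (DiffTop.bigDiagonal L (s j))ᶜ)
    (f : ∀ j, M j → Fin (s j) → L)
    (hf : ∀ j, ContMDiff (𝓡 (m j)) (ModelWithCorners.pi fun _ : Fin (s j) => 𝓡 n) ∞ (f j))
    (𝒰 : Set C^∞⟮𝓡 n, L; 𝓡 n, L⟯) (h𝒰 : IsOpen[DiffTop.smoothTopology L L] 𝒰)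
    (hid : ContMDiffMap.id ∈ 𝒰) :
    ∃ φ : L ≃ₘ⟮𝓡 n, 𝓡 n⟯ L, φ.toContMDiffMap ∈ 𝒰 ∧
      ∀ j, DiffTop.IsTransverse (ModelWithCorners.pi fun _ : Fin (s j) => 𝓡 n) (𝓡 (m j))
        (f j) (DiffTop.powMap (s j) φ '' N j) :=
  mainTheorem10_general hN hNdiag hf h𝒰 hid
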